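/- Let $G$ be a finite group. Let $\mathcal{M}(G)$ be the set of pairs $(H,\varphi)$ with $H\le G$ and $\varphi\colon H\to\mathbb{C}^\times$ a linear character. The group $G$ acts on it by conjugation, ${}^g(H,\varphi)=(gHg^{-1},{}^g\varphi)$ with $({}^g\varphi)(ghg^{-1})=\varphi(h)$; the orbit of $(H,\varphi)$ is written $[H,\varphi]_G$. Let $R(G)$ be the group of virtual characters of $G$ and $R_+(G)$ the free abelian group on the orbits $[H,\varphi]_G$. For $U\le G$ there is the restriction map $R_+(G)\to R_+(U)$, $[H,\varphi]_G\mapsto\sum_{g\in[U\backslash G/H]}[U\cap gHg^{-1},({}^g\varphi)|_{U\cap gHg^{-1}}]_U$. The canonical Brauer induction formula is the unique collection of group homomorphisms $$a_G\colon R(G)\to R_+(G),\qquad \chi\mapsto\sum_{[H,\varphi]_G}\alpha_{[H,\varphi]_G}(\chi)\,[H,\varphi]_G,$$ $G$ running through all finite groups, which commutes with restriction to subgroups and satisfies $\alpha_{[G,\varphi]_G}(\chi)=(\chi,\varphi)$ for all $\chi\in R(G)$ and all linear characters $\varphi$ of $G$; here $(\cdot,\cdot)$ is the Schur inner product. For $\chi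 \in R(G)$ and a positive integer $n$ put $$S(G,\chi,n):=\sum_{[H,\varphi]_G,\ n\mid o(\varphi)}\alpha_{[H,\varphi]_G}(\chi)\in\mathbb{Z},$$ where $o(\varphi)$ is the order of $\varphi$ in the group of linear characters of $H$. For an integer $m$ let $\Psi^m(\chi)(g)=\chi(g^m)$. For a positive integer $m$ and a set $\pi$ of primes let $m_\pi$ be the $\pi$-part of $m$ and $\pi'$ the complementary set of primes. Let $\pi(n)$ be the set of prime divisors of $n$, $\underline{n}:=n/\prod_{p\in\pi(n)}p$, and $n(\rho):=\exp(G)_{\rho'}\cdot\underline{n}_\rho$ for $\rho\subseteq\pi(n)$. **Theorem B.** Let $\chi$ be the character of $G$ afforded by a representation $\mathscr{X}\colon G\to\mathrm{GL}_d(\mathbb{C})$, and let $n$ be a positive divisor of the exponent $\exp(G)$. (a) $S(G,\chi,n)=\sum_{\rho\subseteq\pi(n)}(-1)^{|\rho|}\,(\Psi^{n(\rho)}(\chi),1_G)$. (b) $S(G,\chi,n)\ge 0$. (c) The following are equivalent: (i) there exist a subgroup $H\le G$ and a linear character $\varphi$ of $H$ with $(\chi|_H,\varphi)>0$ and $n=o(\varphi)$;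 (ii) $S(G,\chi,n)>0$; (iii) there exist $x\in G$ and an eigenvalue $\zeta$ of $\mathscr{X}(x)$ whose multiplicative order is $n$. -/

import Mathlib

open scoped ComplexOrder

universe u

namespace BrauerInduction

section Definitions

variable {G : Type u} [Group G]

/-- The function `g ↦ trace (X g)`: the character afforded by a matrix representation `X`. -/
def charOf {d : ℕ} (X : G →* Matrix.GeneralLinearGroup (Fin d) ℂ) : G → ℂ :=
  fun g => Matrix.trace (X g : Matrix (Fin d) (Fin d) ℂ)

/-- A linear character, viewed as a complex valued function. -/
def linChar (φ : G →* ℂˣ) : G → ℂ := fun g => (φ g : ℂ)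

/-- The Schur inner product `|G|⁻¹ ∑ f(g) conj(f'(g))` of complex functions on a finite group. -/
noncomputable def schurInner (f f' : G → ℂ) : ℂ :=
  (Nat.card G : ℂ)⁻¹ * ∑ᶠ g : G, f g * (starRingEnd ℂ) (f' g)

/-- The Adams operation `Ψ^m(f)(g) = f(g^m)`. -/
def adams (m : ℕ) (f : G → ℂ) : G → ℂ := fun g => f (g ^ m)

variable (G) in
/-- The (additive group of the) character ring `R(G)`: the virtual characters of `G`. -/
def CharRing : AddSubgroup (G → ℂ) :=
  AddSubgroup.closure {f | ∃ (d : ℕ) (X : G →* Matrix.GeneralLinearGroup (Fin d) ℂ), charOf X = f}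

/-- A character as an element of the character ring. -/
def charOfMem {d : ℕ} (X : G →* Matrix.GeneralLinearGroup (Fin d) ℂ) : CharRing G :=
  ⟨charOf X, AddSubgroup.subset_closure ⟨d, X, rfl⟩⟩

theorem comp_subtype_mem (U : Subgroup G) (f : G → ℂ) (hf : f ∈ CharRing G) :
    (fun u : U => f u) ∈ CharRing U := by
  induction hf using AddSubgroup.closure_induction with
  | mem f hf =>
    obtain ⟨d, X, rfl⟩ := hf
    exact AddSubgroup.subset_closure ⟨d, X.comp U.subtype, rfl⟩
  | zero => exact (CharRing U).zero_mem
  | add f g _ _ hf hg => exact (CharRing U).add_mem hf hg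
  | neg f _ hf => exact (CharRing U).neg_mem hf

/-- Restriction of virtual characters to a subgroup. -/
def CharRing.res (U : Subgroup G) : CharRing G →+ CharRing U where
  toFun f := ⟨fun u => f.1 u, comp_subtype_mem U f.1 f.2⟩
  map_zero' := rfl
  map_add' _ _ := rfl

variable (G) in
/-- The set `M(G)` of pairs `(H, φ)` with `H ≤ G` and `φ` a linear character of `H`. -/
structure MonPair where
  /-- the subgroup -/
  H : Subgroup G
  /-- the linear character -/
  φ : H →* ℂˣ

namespace MonPair

open Classical in
/-- The function on `G` that extends `φ` by zero outside `H`. -/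
noncomputable def val (p : MonPair G) (x : G) : ℂ := if h : x ∈ p.H then (p.φ ⟨x, h⟩ : ℂ) else 0

theorem val_of_mem (p : MonPair G) {x : G} (h : x ∈ p.H) : p.val x = (p.φ ⟨x, h⟩ : ℂ) := dif_pos h

theorem val_of_not_mem (p : MonPair G) {x : G} (h : x ∉ p.H) : p.val x = 0 := dif_neg h

theorem val_ne_zero {p : MonPair G} {x : G} : p.val x ≠ 0 ↔ x ∈ p.H := by
  by_cases h : x ∈ p.H
  · simp [val_of_mem _ h, h]
  · simp [val_of_not_mem _ h, h]

theorem ext_val {p q : MonPair G} (h : ∀ x, p.val x = q.val x) : p = q := by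
  have hH : p.H = q.H := by
    ext x
    rw [← val_ne_zero, ← val_ne_zero, h]
  obtain ⟨H, φ⟩ := p
  obtain ⟨K, ψ⟩ := q
  obtain rfl : H = K := hH
  congr 1
  ext x
  have := h x
  rwa [val_of_mem _ x.2, val_of_mem _ x.2] at this

/-- Conjugation: `g • (H, φ) = (gHg⁻¹, x ↦ φ(g⁻¹xg))`. -/
instance : SMul G (MonPair G) where
  smul g p :=
    { H := p.H.comap (MulAut.conj g⁻¹).toMonoidHom
      φ := p.φ.comp ((MulAut.conj g⁻¹).toMonoidHom.subgroupComap p.H) }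

theorem mem_smul {g : G} {p : MonPair G} {x : G} : x ∈ (g • p).H ↔ g⁻¹ * x * g ∈ p.H := by
  change (MulAut.conj g⁻¹) x ∈ p.H ↔ _
  simp

theorem smul_val (g : G) (p : MonPair G) (x : G) : (g • p).val x = p.val (g⁻¹ * x * g) := by
  by_cases h : x ∈ (g • p).H
  · rw [val_of_mem _ h, val_of_mem _ (mem_smul.1 h)]
    change ((p.φ ⟨(MulAut.conj g⁻¹) x, _⟩ : ℂˣ) : ℂ) = _
    congr 3
    simp
  · rw [val_of_not_mem _ h, val_of_not_mem _ (fun h' => h (mem_smul.2 h'))]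

instance : MulAction G (MonPair G) where
  one_smul p := ext_val fun x => by simp [smul_val]
  mul_smul g h p := ext_val fun x => by simp [smul_val, mul_assoc]

/-- The restriction `(U ∩ H, φ|_{U ∩ H})` of a pair `(H, φ)`, as a pair of the group `U`. -/
def res (U : Subgroup G) (p : MonPair G) : MonPair U where
  H := p.H.subgroupOf U
  φ := p.φ.comp (U.subtype.subgroupComap p.H)

/-- The pair `(G, φ)`. -/
def ofChar (φ : G →* ℂˣ) : MonPair G where
  H := ⊤
  φ := φ.comp (⊤ : Subgroup G).subtype

variable (G) in
/-- The set of conjugacy classes `[H, φ]_G`. -/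
abbrev Cls : Type u := MulAction.orbitRel.Quotient G (MonPair G)

/-- The class `[H, φ]_G`. -/
def cls (p : MonPair G) : Cls G := Quotient.mk _ p

theorem orderOf_smul (g : G) (p : MonPair G) : orderOf (g • p).φ = orderOf p.φ := by
  have key : ∀ (g : G) (p : MonPair G) (m : ℕ), p.φ ^ m = 1 → (g • p).φ ^ m = 1 := by
    intro g p m h
    ext x
    have := DFunLike.congr_fun h ((MulAut.conj g⁻¹).toMonoidHom.subgroupComap p.H x)
    exact congrArg Units.val this
  rw [orderOf_eq_orderOf_iff]
  intro m
  refine ⟨fun h => ?_, key g p m⟩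
  have h' := key g⁻¹ _ m h
  rwa [inv_smul_smul] at h'

/-- The order `o(φ)` attached to the class `[H, φ]_G`. -/
noncomputable def clsOrder (c : Cls G) : ℕ :=
  Quotient.lift (fun p : MonPair G => orderOf p.φ)
    (by rintro _ p ⟨g, rfl⟩; exact orderOf_smul g p) c

end MonPair

open MonPair

variable (G) in
/-- The free abelian group `R₊(G)` on the set of classes `[H, φ]_G`. -/
abbrev RPlus : Type u := Cls G →₀ ℤ

/-- The element `∑_{g ∈ [U\G/H]} [U ∩ gHg⁻¹, (gφ)|]_U` of `R₊(U)` for a pair `(H, φ)` of `G`. -/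
noncomputable def resPair (U : Subgroup G) (p : MonPair G) : RPlus U :=
  ∑ᶠ q : DoubleCoset.Quotient (U : Set G) (p.H : Set G), Finsupp.single (cls ((q.out • p).res U)) 1

/-- The restriction map `R₊(G) → R₊(U)`. -/
noncomputable def RPlus.res (U : Subgroup G) : RPlus G →+ RPlus U :=
  Finsupp.liftAddHom fun c => zmultiplesHom (RPlus U) (resPair U c.out)

end Definitions

/-- A collection of homomorphisms `a_G : R(G) → R₊(G)`, `G` running through all finite groups, is
canonical if it commutes with restriction to subgroups and if the coefficient of `[G, φ]_G` in
`a_G(χ)` is the multiplicity `(χ, φ)`, for every virtual character `χ` and every linear character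
`φ` of `G`. -/
structure IsCanonical (a : ∀ (G : Type u) [Group G] [Finite G], CharRing G →+ RPlus G) : Prop where
  res_comm : ∀ (G : Type u) [Group G] [Finite G] (U : Subgroup G) (χ : CharRing G),
    RPlus.res U (a G χ) = a U (CharRing.res U χ)
  normalized : ∀ (G : Type u) [Group G] [Finite G] (χ : CharRing G) (φ : G →* ℂˣ),
    (a G χ (MonPair.cls (MonPair.ofChar φ)) : ℂ) = schurInner χ.1 (linChar φ)

section Existence

/-! The rest of this part proves that exactly one canonical collection exists. -/

open MonPair

namespace MonPair

variable {G : Type u} [Group G]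

/-- `(K, ψ) ≤ (H, φ)` if `K ≤ H` and `ψ = φ|_K`. -/
instance : LE (MonPair G) := ⟨fun p q => ∀ x ∈ p.H, q.val x = p.val x⟩

theorem le_def {p q : MonPair G} : p ≤ q ↔ ∀ x ∈ p.H, q.val x = p.val x := Iff.rfl

theorem H_le {p q : MonPair G} (h : p ≤ q) : p.H ≤ q.H := fun x hx => by
  rw [← val_ne_zero, h x hx]
  exact val_ne_zero.2 hx

theorem le_rfl' (p : MonPair G) : p ≤ p := fun _ _ => rfl

theorem eq_of_le {p q : MonPair G} (h : p ≤ q) (h' : q.H ≤ p.H) : p = q :=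
  ext_val fun x => by
    by_cases hx : x ∈ p.H
    · exact (h x hx).symm
    · rw [val_of_not_mem _ hx, val_of_not_mem _ (fun hq => hx (h' hq))]

theorem smul_le_smul' {p q : MonPair G} (g : G) (h : p ≤ q) : g • p ≤ g • q := fun x hx => by
  rw [smul_val, smul_val]
  exact h _ (mem_smul.1 hx)

theorem smul_le_iff {p q : MonPair G} (g : G) : g • p ≤ q ↔ p ≤ g⁻¹ • q := by
  constructor
  · intro h
    simpa using smul_le_smul' g⁻¹ h
  · intro h
    simpa using smul_le_smul' g h

theorem smul_le_smul_iff' {p q : MonPair G} (g : G) : g • p ≤ g • q ↔ p ≤ q := by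
  rw [smul_le_iff, inv_smul_smul]

theorem val_mul (p : MonPair G) {x y : G} (hx : x ∈ p.H) (hy : y ∈ p.H) :
    p.val (x * y) = p.val x * p.val y := by
  rw [val_of_mem _ hx, val_of_mem _ hy, val_of_mem _ (p.H.mul_mem hx hy), ← Units.val_mul,
    ← map_mul]
  rfl

theorem val_one (p : MonPair G) : p.val 1 = 1 := by
  rw [val_of_mem _ p.H.one_mem]
  have : (⟨1, p.H.one_mem⟩ : p.H) = 1 := rfl
  rw [this, map_one, Units.val_one]

theorem smul_self_of_mem (p : MonPair G) {h : G} (hh : h ∈ p.H) : h • p = p := ext_val fun x => by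
  rw [smul_val]
  by_cases hx : x ∈ p.H
  · have hi := p.H.inv_mem hh
    rw [val_mul _ (p.H.mul_mem hi hx) hh, val_mul _ hi hx, mul_right_comm, ← val_mul _ hi hh,
      inv_mul_cancel, val_one, one_mul]
  · rw [val_of_not_mem _ hx, val_of_not_mem]
    rwa [p.H.mul_mem_cancel_right hh, p.H.mul_mem_cancel_left (p.H.inv_mem hh)]

theorem card_smul (g : G) (p : MonPair G) : Nat.card (g • p).H = Nat.card p.H := by
  refine Nat.card_congr ⟨fun x => ⟨g⁻¹ * x * g, mem_smul.1 x.2⟩,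
    fun x => ⟨g * x * g⁻¹, mem_smul.2 ?_⟩, fun x => ?_, fun x => ?_⟩
  · simp [mul_assoc]
  · ext; simp [mul_assoc]
  · ext; simp [mul_assoc]

instance [Finite G] : Finite (MonPair G) := by
  have hS : ({0} ∪ {z : ℂ | z ^ Nat.card G = 1}).Finite := by
    refine (Set.finite_singleton _).union ?_
    have h := Polynomial.X_pow_sub_C_ne_zero (R := ℂ) (Nat.card_pos (α := G)) 1
    refine (Polynomial.finite_setOfPred_isRoot h).subset fun z hz => ?_
    simpa [Polynomial.IsRoot, sub_eq_zero] using hz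
  have := (Set.Finite.pi' (fun _ : G => hS)).to_subtype
  refine Finite.of_injective
    (β := {f : G → ℂ | ∀ i, f i ∈ ({0} ∪ {z : ℂ | z ^ Nat.card G = 1})})
    (fun p => ⟨p.val, fun x => ?_⟩) fun p q h => ext_val fun x => congrFun (congrArg Subtype.val h) x
  by_cases hx : x ∈ p.H
  · right
    rw [val_of_mem _ hx, Set.mem_ofPred_eq, ← Units.val_pow_eq_pow_val, ← map_pow]
    have : (⟨x, hx⟩ : p.H) ^ Nat.card G = 1 := by
      ext; exact pow_card_eq_one'
    rw [this, map_one, Units.val_one]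
  · left
    exact val_of_not_mem _ hx

theorem cls_eq_cls {p q : MonPair G} : cls p = cls q ↔ ∃ g : G, g • q = p :=
  Quotient.eq.trans Iff.rfl

theorem cls_smul (g : G) (p : MonPair G) : cls (g • p) = cls p := cls_eq_cls.2 ⟨g, rfl⟩

theorem cls_out (c : Cls G) : cls c.out = c := Quotient.out_eq c

theorem exists_out (p : MonPair G) : ∃ g : G, (cls p).out = g • p := by
  obtain ⟨g, hg⟩ := cls_eq_cls.1 (cls_out (cls p))
  exact ⟨g, hg.symm⟩

/-! ### Marks -/

/-- The number of `gH` with `p ≤ g • (H, φ)`. -/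
noncomputable def weight (p q : MonPair G) : ℚ :=
  (Nat.card {g : G // p ≤ g • q} : ℚ) / Nat.card q.H

theorem weight_smul_right (p q : MonPair G) (g : G) : weight p (g • q) = weight p q := by
  unfold weight
  rw [card_smul]
  congr 2
  exact Nat.card_congr ((Equiv.mulRight g).subtypeEquiv fun x => by simp [mul_smul])

theorem weight_smul_left (p q : MonPair G) (g : G) : weight (g • p) q = weight p q := by
  unfold weight
  congr 2
  exact Nat.card_congr ((Equiv.mulLeft g⁻¹).subtypeEquiv fun x => by
    simp [mul_smul, smul_le_iff])

/-- The linear extension of `weight p`. -/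
noncomputable def mark (p : MonPair G) : RPlus G →+ ℚ :=
  Finsupp.liftAddHom fun c => zmultiplesHom ℚ (weight p c.out)

theorem mark_single (p q : MonPair G) (k : ℤ) :
    mark p (Finsupp.single (cls q) k) = k * weight p q := by
  obtain ⟨g, hg⟩ := exists_out q
  simp [mark, hg, weight_smul_right]

theorem mark_smul (p : MonPair G) (g : G) (b : RPlus G) : mark (g • p) b = mark p b := by
  unfold mark
  simp only [weight_smul_left]

theorem mark_eq_sum (p : MonPair G) (b : RPlus G) :
    mark p b = ∑ c ∈ b.support, (b c : ℚ) * weight p c.out := by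
  simp [mark, Finsupp.liftAddHom_apply, Finsupp.sum]

/-- A pair of the subgroup `U`, viewed as a pair of `G`. -/
noncomputable def map {U : Subgroup G} (p : MonPair U) : MonPair G where
  H := p.H.map U.subtype
  φ := p.φ.comp (p.H.equivMapOfInjective U.subtype U.subtype_injective).symm.toMonoidHom

theorem map_val {U : Subgroup G} (p : MonPair U) (x : U) : p.map.val x = p.val x := by
  by_cases hx : x ∈ p.H
  · have h : (x : G) ∈ p.map.H := ⟨x, hx, rfl⟩
    rw [val_of_mem _ hx, val_of_mem _ h]
    change ((p.φ ((p.H.equivMapOfInjective U.subtype U.subtype_injective).symm ⟨x, h⟩) : ℂˣ) : ℂ)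
      = _
    congr 2
    rw [MulEquiv.symm_apply_eq]
    rfl
  · rw [val_of_not_mem _ hx, val_of_not_mem]
    rintro ⟨y, hy, hyx⟩
    exact hx (by rwa [← Subtype.ext hyx])

variable [Finite G]

theorem card_H_pos (p : MonPair G) : 0 < Nat.card p.H := Nat.card_pos

theorem card_le_of_le {p q : MonPair G} {g : G} (h : p ≤ g • q) : Nat.card p.H ≤ Nat.card q.H := by
  rw [← card_smul g q]
  exact Subgroup.card_le_of_le (H_le h)

theorem eq_of_le_of_card {p q : MonPair G} {g : G} (h : p ≤ g • q)
    (hc : Nat.card q.H ≤ Nat.card p.H) : p = g • q := by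
  refine eq_of_le h (le_of_eq (Subgroup.eq_of_le_of_card_ge (H_le h) ?_).symm)
  rwa [card_smul]

theorem weight_eq_zero {p q : MonPair G} (hc : Nat.card q.H ≤ Nat.card p.H)
    (h : cls p ≠ cls q) : weight p q = 0 := by
  have : IsEmpty {g : G // p ≤ g • q} :=
    ⟨fun g => h (cls_eq_cls.2 ⟨g.1, (eq_of_le_of_card g.2 hc).symm⟩)⟩
  simp [weight]

theorem weight_self (p : MonPair G) :
    weight p p = (Nat.card (MulAction.stabilizer G p) : ℚ) / Nat.card p.H := by
  unfold weight
  congr 2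
  refine Nat.card_congr (Equiv.subtypeEquivRight fun g => ⟨fun h => ?_, fun h => ?_⟩)
  · exact (eq_of_le_of_card h (Nat.le_refl _)).symm
  · rw [MulAction.mem_stabilizer_iff.1 h]
    exact le_rfl' p

theorem weight_self_pos (p : MonPair G) : 0 < weight p p := by
  rw [weight_self]
  have := card_H_pos p
  have : 0 < Nat.card (MulAction.stabilizer G p) := Nat.card_pos
  positivity

theorem mark_injective {b : RPlus G} (h : ∀ p, mark p b = 0) : b = 0 := by
  by_contra hb
  obtain ⟨c, hc, hmax⟩ := b.support.exists_max_image (fun c => Nat.card c.out.H)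
    (Finsupp.support_nonempty_iff.2 hb)
  have h1 := h c.out
  rw [mark_eq_sum, Finset.sum_eq_single_of_mem c hc] at h1
  · have := (weight_self_pos c.out).ne'
    simp_all
  · intro d hd hdc
    rw [weight_eq_zero (hmax d hd), mul_zero]
    rw [cls_out, cls_out]
    exact hdc.symm

section Restriction

variable {G : Type u} [Group G]

theorem mem_res {U : Subgroup G} {p : MonPair G} {x : U} : x ∈ (p.res U).H ↔ (x : G) ∈ p.H :=
  Iff.rfl

theorem res_val (U : Subgroup G) (p : MonPair G) (x : U) : (p.res U).val x = p.val x := by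
  by_cases h : (x : G) ∈ p.H
  · rw [val_of_mem _ h, val_of_mem _ (mem_res.2 h)]
    rfl
  · rw [val_of_not_mem _ h, val_of_not_mem _ (fun h' => h (mem_res.1 h'))]

theorem smul_res (U : Subgroup G) (u : U) (p : MonPair G) :
    u • p.res U = ((u : G) • p).res U := ext_val fun x => by
  simp [smul_val, res_val]

theorem mem_map {U : Subgroup G} {p : MonPair U} {x : G} : x ∈ p.map.H ↔ ∃ y ∈ p.H, (y : G) = x :=
  Iff.rfl

theorem le_res_iff {U : Subgroup G} {p : MonPair U} {q : MonPair G} :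
    p ≤ q.res U ↔ p.map ≤ q := by
  simp only [le_def, res_val]
  constructor
  · intro h x hx
    obtain ⟨y, hy, rfl⟩ := mem_map.1 hx
    rw [h y hy, map_val]
  · intro h x hx
    rw [h x (mem_map.2 ⟨x, hx, rfl⟩), map_val]

theorem doubleCoset_count [Finite G] (U H : Subgroup G) (P : G → Prop)
    (hP : ∀ x, ∀ h ∈ H, P (x * h) ↔ P x) (q : DoubleCoset.Quotient (U : Set G) (H : Set G)) :
    Nat.card {x : G // DoubleCoset.mk U H x = q ∧ P x} *
      Nat.card {v : U // q.out⁻¹ * (v : G) * q.out ∈ H} =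
    Nat.card {u : U // P (u * q.out)} * Nat.card H := by
  have hdec : ∀ x : G, DoubleCoset.mk U H x = q → ∃ (u : U) (h : H), x = u * q.out * h := by
    intro x hx
    rw [← DoubleCoset.out_eq' U H q, eq_comm, DoubleCoset.eq] at hx
    obtain ⟨a, ha, b, hb, h⟩ := hx
    exact ⟨⟨a, ha⟩, ⟨b, hb⟩, h⟩
  choose! u h huh using hdec
  have hback : ∀ (w : U) (k : G), k ∈ H → DoubleCoset.mk U H ((w : G) * q.out * k) = q := by
    intro w k hk
    have h1 : DoubleCoset.mk U H ((w : G) * q.out * k) = DoubleCoset.mk U H q.out :=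
      ((DoubleCoset.eq U H _ _).2 ⟨w, w.2, k, hk, rfl⟩).symm
    rw [h1, DoubleCoset.out_eq']
  rw [← Nat.card_prod, ← Nat.card_prod]
  refine Nat.card_congr
    { toFun := fun z => (⟨u z.1.1 * z.2.1, ?_⟩, ⟨q.out⁻¹ * (z.2.1 : G)⁻¹ * q.out * h z.1.1, ?_⟩)
      invFun := fun z => (⟨z.1.1 * q.out * z.2, ?_, ?_⟩,
        ⟨(u (z.1.1 * q.out * z.2))⁻¹ * z.1.1, ?_⟩)
      left_inv := ?_
      right_inv := ?_ }
  · obtain ⟨⟨x, hx, hPx⟩, ⟨v, hv⟩⟩ := z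
    have e := huh x hx
    have : ((u x * v : U) : G) * q.out = x * ((h x : G)⁻¹ * (q.out⁻¹ * v * q.out)) := by
      nth_rewrite 2 [e]
      push_cast
      group
    change P (((u x * v : U) : G) * q.out)
    rw [this, hP _ _ (H.mul_mem (H.inv_mem (h x).2) hv)]
    exact hPx
  · obtain ⟨⟨x, hx, hPx⟩, ⟨v, hv⟩⟩ := z
    refine H.mul_mem ?_ (h x).2
    have := H.inv_mem hv
    simpa [mul_assoc] using this
  · exact hback _ _ z.2.2
  · rw [hP _ _ z.2.2]
    exact z.1.2
  · have hx : DoubleCoset.mk U H ((z.1.1 : G) * q.out * z.2) = q := hback _ _ z.2.2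
    have e := huh _ hx
    have : q.out⁻¹ * (((u ((z.1.1 : G) * q.out * z.2))⁻¹ * z.1.1 : U) : G) * q.out =
        (h ((z.1.1 : G) * q.out * z.2) : G) * (z.2 : G)⁻¹ := by
      rw [eq_mul_inv_iff_mul_eq]
      push_cast
      rw [mul_assoc, mul_assoc, mul_assoc, inv_mul_eq_iff_eq_mul, inv_mul_eq_iff_eq_mul]
      rw [← mul_assoc, ← mul_assoc, ← e]
    rw [this]
    exact H.mul_mem (h _).2 (H.inv_mem z.2.2)
  · rintro ⟨⟨x, hx, hPx⟩, ⟨v, hv⟩⟩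
    have e := huh x hx
    have : ((u x * v : U) : G) * q.out * (q.out⁻¹ * (v : G)⁻¹ * q.out * h x) = x := by
      nth_rewrite 3 [e]
      push_cast
      group
    ext
    · exact this
    · change (((u (((u x * v : U) : G) * q.out * (q.out⁻¹ * (v : G)⁻¹ * q.out * h x)))⁻¹ *
        (u x * v) : U) : G) = v
      rw [this]
      simp
  · rintro ⟨⟨w, hw⟩, ⟨k, hk⟩⟩
    have hx : DoubleCoset.mk U H ((w : G) * q.out * k) = q := hback _ _ hk
    have e := huh _ hx
    ext
    · simp
    · change q.out⁻¹ * (((u ((w : G) * q.out * k))⁻¹ * w : U) : G)⁻¹ * q.out *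
        h ((w : G) * q.out * k) = k
      push_cast
      rw [mul_inv_rev, inv_inv]
      have : q.out⁻¹ * ((w : G)⁻¹ * (u ((w : G) * q.out * k) : G)) * q.out *
        h ((w : G) * q.out * k) = q.out⁻¹ * (w : G)⁻¹ * ((u ((w : G) * q.out * k) : G) * q.out *
        h ((w : G) * q.out * k)) := by group
      rw [this, ← e]
      group

theorem weight_map [Finite G] (U : Subgroup G) (p : MonPair U) (r : MonPair G) :
    mark p (resPair U r) = weight p.map r := by
  classical
  have : Finite (DoubleCoset.Quotient (U : Set G) (r.H : Set G)) := Quotient.finite _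
  have := Fintype.ofFinite (DoubleCoset.Quotient (U : Set G) (r.H : Set G))
  have := Fintype.ofFinite G
  have hr : (Nat.card r.H : ℚ) ≠ 0 := by
    have := card_H_pos r
    positivity
  have key : ∀ q : DoubleCoset.Quotient (U : Set G) (r.H : Set G),
      weight p ((q.out • r).res U) =
        (Nat.card {x : G // DoubleCoset.mk U r.H x = q ∧ p.map ≤ x • r} : ℚ) / Nat.card r.H := by
    intro q
    have h := doubleCoset_count U r.H (fun x => p.map ≤ x • r)
      (fun x k hk => by rw [mul_smul, smul_self_of_mem r hk]) q
    have e1 : Nat.card {u : U // p ≤ u • (q.out • r).res U} =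
        Nat.card {u : U // p.map ≤ ((u : G) * q.out) • r} :=
      Nat.card_congr (Equiv.subtypeEquivRight fun u => by
        rw [smul_res, le_res_iff, mul_smul])
    have e2 : Nat.card ((q.out • r).res U).H = Nat.card {v : U // q.out⁻¹ * (v : G) * q.out ∈ r.H} :=
      Nat.card_congr (Equiv.subtypeEquivRight fun u => by rw [mem_res, mem_smul])
    have hv : (Nat.card ((q.out • r).res U).H : ℚ) ≠ 0 := by
      have := card_H_pos ((q.out • r).res U)
      positivity
    unfold weight
    rw [div_eq_div_iff hv hr, e1, e2]
    exact_mod_cast h.symm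
  unfold resPair
  rw [finsum_eq_sum_of_fintype, map_sum]
  simp only [mark_single, key, Int.cast_one, one_mul]
  rw [← Finset.sum_div]
  unfold weight
  congr 1
  rw [← Nat.cast_sum]
  congr 1
  simp only [Nat.card_eq_fintype_card, Fintype.card_subtype]
  rw [Finset.card_eq_sum_card_fiberwise (f := fun x => DoubleCoset.mk U r.H x)
    (t := Finset.univ) (fun _ _ => Finset.mem_coe.2 (Finset.mem_univ _))]
  refine Finset.sum_congr rfl fun q _ => ?_
  rw [Finset.filter_filter]
  congr 1
  ext x
  simp [and_comm]

theorem mark_res [Finite G] (U : Subgroup G) (p : MonPair U) (b : RPlus G) :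
    mark p (RPlus.res U b) = mark p.map b := by
  induction b using Finsupp.induction_linear with
  | zero => simp
  | add f g hf hg => rw [map_add, map_add, map_add, hf, hg]
  | single c k =>
    have h1 : RPlus.res U (Finsupp.single c k) = k • resPair U c.out := by simp [RPlus.res]
    have h2 : mark p.map (Finsupp.single c k) = k * weight p.map c.out := by simp [mark]
    rw [h1, h2, map_zsmul, weight_map, zsmul_eq_mul]

end Restriction

section Congruences

open Classical

variable {G : Type u} [Group G]

/-- The pairs extending `p` to the subgroup generated by `p.H` and `n`. -/
def IsExt (p : MonPair G) (n : G) (r : MonPair G) : Prop :=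
  p ≤ r ∧ r.H = p.H ⊔ Subgroup.zpowers n

/-- The restriction of a pair to a smaller subgroup. -/
def restr (r : MonPair G) (K : Subgroup G) (hK : K ≤ r.H) : MonPair G :=
  ⟨K, r.φ.comp (Subgroup.inclusion hK)⟩

theorem restr_le (r : MonPair G) (K : Subgroup G) (hK : K ≤ r.H) : r.restr K hK ≤ r := by
  intro x hx
  rw [val_of_mem _ hx, val_of_mem _ (hK hx)]
  rfl

theorem eq_of_le_le {p q r : MonPair G} (hp : p ≤ r) (hq : q ≤ r) (h : p.H = q.H) : p = q :=
  eq_of_le (fun x hx => by rw [← hp x hx, ← hq x (h ▸ hx)]) h.ge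

theorem exists_isExt_le {p r : MonPair G} {n : G} :
    (∃ s, IsExt p n s ∧ s ≤ r) ↔ p ≤ r ∧ n ∈ r.H := by
  constructor
  · rintro ⟨s, ⟨h1, h2⟩, h3⟩
    refine ⟨fun x hx => ?_, H_le h3 ?_⟩
    · rw [h3 x (H_le h1 hx), h1 x hx]
    · rw [h2]
      exact Subgroup.mem_sup_right (Subgroup.mem_zpowers n)
  · rintro ⟨h1, h2⟩
    have hK : p.H ⊔ Subgroup.zpowers n ≤ r.H := sup_le (H_le h1) (by simpa using h2)
    refine ⟨r.restr _ hK, ⟨fun x hx => ?_, rfl⟩, restr_le _ _ _⟩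
    rw [← h1 x hx]
    exact (restr_le r _ hK x (Subgroup.mem_sup_left hx)).symm

theorem isExt_of_mem {p r : MonPair G} {n : G} (hn : n ∈ p.H) : IsExt p n r ↔ r = p := by
  have h : p.H ⊔ Subgroup.zpowers n = p.H := sup_eq_left.2 (by simpa using hn)
  unfold IsExt
  rw [h]
  constructor
  · rintro ⟨h1, h2⟩
    exact (eq_of_le h1 h2.le).symm
  · rintro rfl
    exact ⟨le_rfl' _, rfl⟩

theorem card_lt_of_isExt [Finite G] {p r : MonPair G} {n : G} (hn : n ∉ p.H) (h : IsExt p n r) :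
    Nat.card p.H < Nat.card r.H := by
  refine lt_of_le_of_ne (Subgroup.card_le_of_le (H_le h.1)) fun hc => hn ?_
  rw [Subgroup.eq_of_le_of_card_ge (H_le h.1) hc.ge, h.2]
  exact Subgroup.mem_sup_right (Subgroup.mem_zpowers n)

variable [Fintype G] [Fintype (MonPair G)]

/-- The congruences that characterize the image of the mark homomorphism. -/
def Cong (x : MonPair G → ℚ) : Prop :=
  ∀ p, ∃ k : ℤ, ∑ n : MulAction.stabilizer G p, ∑ r : MonPair G with IsExt p n r, x r =
    Nat.card (MulAction.stabilizer G p) * k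

theorem sum_ext_card (p q : MonPair G) (n : G) :
    ∑ r : MonPair G with IsExt p n r, Nat.card {g : G // r ≤ g • q} =
      Nat.card {g : G // p ≤ g • q ∧ n ∈ (g • q).H} := by
  simp only [Nat.card_eq_fintype_card, Fintype.card_subtype, Finset.card_filter]
  rw [Finset.sum_comm]
  refine Finset.sum_congr rfl fun g _ => ?_
  rw [← Finset.sum_filter, Finset.filter_filter, Finset.sum_const, smul_eq_mul, mul_one]
  split_ifs with h
  · rw [Finset.card_eq_one]
    obtain ⟨s, hs, hs'⟩ := exists_isExt_le.2 h
    refine ⟨s, ?_⟩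
    ext t
    simp only [Finset.mem_filter, Finset.mem_univ, true_and, Finset.mem_singleton]
    constructor
    · rintro ⟨h1, h2⟩
      exact eq_of_le_le h2 hs' (h1.2.trans hs.2.symm)
    · rintro rfl
      exact ⟨hs, hs'⟩
  · rw [Finset.card_eq_zero, Finset.filter_eq_empty_iff]
    intro t _ ht
    exact h (exists_isExt_le.1 ⟨t, ht⟩)

theorem burnside_count (p q : MonPair G) : ∃ k : ℕ,
    ∑ n : MulAction.stabilizer G p, Nat.card {g : G // p ≤ g • q ∧ (n : G) ∈ (g • q).H} =
      k * (Nat.card (MulAction.stabilizer G p) * Nat.card q.H) := by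
  let act : MulAction (MulAction.stabilizer G p × q.H) {g : G // p ≤ g • q} :=
    { smul := fun z g => ⟨z.1 * g.1 * (z.2 : G)⁻¹, by
        have h := smul_le_smul' (z.1 : G) g.2
        rw [MulAction.mem_stabilizer_iff.1 z.1.2] at h
        rwa [mul_smul, mul_smul, smul_self_of_mem q (q.H.inv_mem z.2.2)]⟩
      one_smul := fun g => Subtype.ext (by
        change ((1 : MulAction.stabilizer G p) : G) * g.1 * ((1 : q.H) : G)⁻¹ = g.1
        simp)
      mul_smul := fun z w g => Subtype.ext (by
        change ((z.1 * w.1 : MulAction.stabilizer G p) : G) * g.1 * ((z.2 * w.2 : q.H) : G)⁻¹ =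
          z.1 * (w.1 * g.1 * (w.2 : G)⁻¹) * (z.2 : G)⁻¹
        push_cast
        group) }
  have B := MulAction.sum_card_fixedBy_eq_card_orbits_mul_card_group
    (MulAction.stabilizer G p × q.H) {g : G // p ≤ g • q}
  rw [Fintype.card_prod, ← Nat.card_eq_fintype_card (α := MulAction.stabilizer G p),
    ← Nat.card_eq_fintype_card (α := q.H)] at B
  refine ⟨_, Eq.trans ?_ B⟩
  rw [Fintype.sum_prod_type]
  refine Finset.sum_congr rfl fun n _ => ?_
  rw [← Fintype.card_sigma, ← Nat.card_eq_fintype_card]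
  refine Nat.card_congr
    { toFun := fun g => ⟨⟨g.1⁻¹ * n * g.1, mem_smul.1 g.2.2⟩, ⟨⟨g.1, g.2.1⟩, Subtype.ext ?_⟩⟩
      invFun := fun z => ⟨z.2.1.1, z.2.1.2, mem_smul.2 ?_⟩
      left_inv := ?_
      right_inv := ?_ }
  · change (n : G) * g.1 * (g.1⁻¹ * n * g.1)⁻¹ = g.1
    group
  · obtain ⟨k, ⟨g, hg⟩, hz⟩ := z
    have h : (n : G) * g * (k : G)⁻¹ = g := congrArg Subtype.val hz
    have : g⁻¹ * n * g = k := by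
      rw [mul_assoc, inv_mul_eq_iff_eq_mul, ← mul_inv_eq_iff_eq_mul]
      exact h
    change g⁻¹ * n * g ∈ q.H
    rw [this]
    exact k.2
  · intro g
    rfl
  · rintro ⟨⟨k, hk⟩, ⟨g, hg⟩, hz⟩
    have h : (n : G) * g * k⁻¹ = g := congrArg Subtype.val hz
    obtain rfl : g⁻¹ * n * g = k := by
      rw [mul_assoc, inv_mul_eq_iff_eq_mul, ← mul_inv_eq_iff_eq_mul]
      exact h
    rfl

theorem Cong.zero : Cong (fun _ : MonPair G => (0 : ℚ)) := fun p => ⟨0, by simp⟩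

theorem Cong.add {x y : MonPair G → ℚ} (hx : Cong x) (hy : Cong y) :
    Cong (fun p => x p + y p) := fun p => by
  obtain ⟨k, hk⟩ := hx p
  obtain ⟨l, hl⟩ := hy p
  refine ⟨k + l, ?_⟩
  simp only [Finset.sum_add_distrib, hk, hl]
  push_cast
  ring

theorem Cong.neg {x : MonPair G → ℚ} (hx : Cong x) : Cong (fun p => - x p) := fun p => by
  obtain ⟨k, hk⟩ := hx p
  refine ⟨-k, ?_⟩
  simp only [Finset.sum_neg_distrib, hk]
  push_cast
  ring

theorem cong_mark (b : RPlus G) : Cong (fun p => mark p b) := by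
  induction b using Finsupp.induction_linear with
  | zero => simpa using Cong.zero
  | add f g hf hg => simpa using hf.add hg
  | single c j =>
    intro p
    obtain ⟨k, hk⟩ := burnside_count p c.out
    refine ⟨j * k, ?_⟩
    have h0 : (Nat.card c.out.H : ℚ) ≠ 0 := by
      have := card_H_pos c.out
      positivity
    have h1 : ∀ r : MonPair G, mark r (Finsupp.single c j) =
        j * ((Nat.card {g : G // r ≤ g • c.out} : ℕ) : ℚ) / Nat.card c.out.H := by
      intro r
      simp [mark, weight, mul_div_assoc]
    simp only [h1]
    simp only [← Finset.sum_div, ← Finset.mul_sum, ← Nat.cast_sum, sum_ext_card, hk]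
    push_cast
    field_simp

theorem Cong.top {x : MonPair G → ℚ} (hx : Cong x) (p : MonPair G)
    (h : ∀ r, Nat.card p.H < Nat.card r.H → x r = 0) : ∃ k : ℤ, x p = k * weight p p := by
  obtain ⟨k, hk⟩ := hx p
  refine ⟨k, ?_⟩
  have h0 : (Nat.card p.H : ℚ) ≠ 0 := by
    have := card_H_pos p
    positivity
  have hle : p.H ≤ MulAction.stabilizer G p := fun g hg => smul_self_of_mem p hg
  have h1 : ∀ n : MulAction.stabilizer G p, ∑ r : MonPair G with IsExt p n r, x r =
      if (n : G) ∈ p.H then x p else 0 := by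
    intro n
    split_ifs with hn
    · rw [Finset.sum_congr (s₂ := {p}) _ (fun _ _ => rfl), Finset.sum_singleton]
      ext r
      simp [isExt_of_mem hn]
    · refine Finset.sum_eq_zero fun r hr => h r (card_lt_of_isExt hn ?_)
      simpa using hr
  have h2 : Nat.card {n : MulAction.stabilizer G p // (n : G) ∈ p.H} = Nat.card p.H :=
    Nat.card_congr
      { toFun := fun n => ⟨n.1, n.2⟩
        invFun := fun n => ⟨⟨n.1, hle n.2⟩, n.2⟩
        left_inv := fun _ => rfl
        right_inv := fun _ => rfl }
  simp only [h1] at hk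
  rw [← Finset.sum_filter, Finset.sum_const, ← Fintype.card_subtype, ← Nat.card_eq_fintype_card,
    h2, nsmul_eq_mul] at hk
  rw [weight_self, ← mul_div_assoc, eq_div_iff h0, mul_comm, hk, mul_comm]

theorem exists_of_cong_aux (j : ℕ) : ∀ x : MonPair G → ℚ, (∀ (g : G) p, x (g • p) = x p) →
    Cong x → (∀ p, j < Nat.card p.H → x p = 0) → ∃ b : RPlus G, ∀ p, mark p b = x p := by
  induction j with
  | zero =>
    intro x _ _ h
    exact ⟨0, fun p => by rw [map_zero, h p (card_H_pos p)]⟩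
  | succ j ih =>
    intro x hinv hx h
    have hk : ∀ c : Cls G, ∃ k : ℤ, Nat.card c.out.H = j + 1 → x c.out = k * weight c.out c.out := by
      intro c
      by_cases hc : Nat.card c.out.H = j + 1
      · obtain ⟨k, hk⟩ := hx.top c.out (fun r hr => h r (hc ▸ hr))
        exact ⟨k, fun _ => hk⟩
      · exact ⟨0, fun h' => absurd h' hc⟩
    choose k hk using hk
    have : Fintype (Cls G) := Fintype.ofFinite _
    let b : RPlus G := Finsupp.equivFunOnFinite.symm
      fun c => if Nat.card c.out.H = j + 1 then k c else 0
    have hb : ∀ p, mark p b =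
        ∑ c : Cls G, ((if Nat.card c.out.H = j + 1 then k c else 0 : ℤ) : ℚ) * weight p c.out := by
      intro p
      rw [mark_eq_sum]
      refine Finset.sum_subset (Finset.subset_univ _) fun c _ hc => ?_
      rw [Finsupp.notMem_support_iff] at hc
      rw [hc, Int.cast_zero, zero_mul]
    have hvan : ∀ p, j < Nat.card p.H → x p - mark p b = 0 := by
      intro p hp
      obtain ⟨g, hg⟩ := exists_out p
      have hcg : Nat.card (cls p).out.H = Nat.card p.H := by rw [hg, card_smul]
      rw [hb, Finset.sum_eq_single (cls p)]
      · rcases eq_or_lt_of_le (Nat.succ_le_of_lt hp) with hp' | hp'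
        · have hc : Nat.card (cls p).out.H = j + 1 := by rw [hcg, ← hp']
          have := hk _ hc
          rw [if_pos hc]
          rw [hg, hinv, weight_smul_left] at this
          rw [this, hg, sub_self]
        · rw [if_neg (by rw [hcg]; exact hp'.ne'), h p hp']
          simp
      · intro c _ hc
        split_ifs with hc'
        · rw [weight_eq_zero, mul_zero]
          · rw [hc']
            exact hp
          · rw [cls_out]
            exact hc.symm
        · simp
      · simp
    obtain ⟨b', hb'⟩ := ih (fun p => x p + -mark p b)
      (fun g p => by rw [hinv, mark_smul]) (hx.add (cong_mark b).neg)
      (fun p hp => by rw [← sub_eq_add_neg]; exact hvan p hp)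
    exact ⟨b' + b, fun p => by rw [map_add, hb']; ring⟩

theorem exists_of_cong {x : MonPair G → ℚ} (hinv : ∀ (g : G) p, x (g • p) = x p)
    (hx : Cong x) : ∃ b : RPlus G, ∀ p, mark p b = x p :=
  exists_of_cong_aux (Nat.card G) x hinv hx fun p hp =>
    absurd hp (not_lt.2 (Subgroup.card_le_card_group p.H))

end Congruences

section Multiplicities

variable {G : Type u} [Group G]

/-- The multiplicity `(f|_H, φ)` for a pair `p = (H, φ)`. -/
noncomputable def mult (f : G → ℂ) (p : MonPair G) : ℂ :=
  schurInner (fun h : p.H => f h) (linChar p.φ)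

open Classical in
theorem mult_eq (f : G → ℂ) (p : MonPair G) :
    mult f p = (Nat.card p.H : ℂ)⁻¹ * ∑ᶠ x : G, f x * (starRingEnd ℂ) (p.val x) := by
  unfold mult schurInner
  congr 1
  have h1 : ∀ h : p.H, f h * (starRingEnd ℂ) (linChar p.φ h) =
      f h * (starRingEnd ℂ) (p.val h) := fun h => by rw [val_of_mem _ h.2]; rfl
  rw [finsum_congr h1]
  refine (finsum_set_coe_eq_finsum_mem (f := fun x => f x * (starRingEnd ℂ) (p.val x))
    (p.H : Set G)).trans ?_
  refine finsum_congr fun x => ?_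
  by_cases hx : x ∈ p.H
  · rw [finsum_eq_if, if_pos (show x ∈ (p.H : Set G) from hx)]
  · rw [finsum_eq_if, if_neg (show x ∉ (p.H : Set G) from hx), val_of_not_mem _ hx]
    simp

theorem mult_smul (f : G → ℂ) (hf : ∀ g x, f (g⁻¹ * x * g) = f x) (g : G) (p : MonPair G) :
    mult f (g • p) = mult f p := by
  rw [mult_eq, mult_eq, card_smul]
  congr 1
  refine finsum_eq_of_bijective (fun x => g⁻¹ * x * g) ?_ fun x => ?_
  · have : (fun x => g⁻¹ * x * g) = (MulAut.conj g⁻¹ : G → G) := by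
      ext x
      simp
    rw [this]
    exact (MulAut.conj g⁻¹).bijective
  · rw [hf, smul_val]

theorem card_map {U : Subgroup G} (p : MonPair U) : Nat.card p.map.H = Nat.card p.H :=
  Nat.card_congr (p.H.equivMapOfInjective U.subtype U.subtype_injective).toEquiv.symm

open Classical in
theorem mult_map {U : Subgroup G} (f : G → ℂ) (p : MonPair U) :
    mult (fun u : U => f u) p = mult f p.map := by
  rw [mult_eq, mult_eq, card_map]
  congr 1
  simp only [← map_val]
  refine (finsum_set_coe_eq_finsum_mem (f := fun x => f x * (starRingEnd ℂ) (p.map.val x))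
    (U : Set G)).trans ?_
  refine finsum_congr fun x => ?_
  by_cases hx : x ∈ U
  · rw [finsum_eq_if, if_pos (show x ∈ (U : Set G) from hx)]
  · rw [finsum_eq_if, if_neg (show x ∉ (U : Set G) from hx), val_of_not_mem]
    · simp
    · rintro ⟨y, _, rfl⟩
      exact hx y.2

theorem mult_add (f f' : G → ℂ) [Finite G] (p : MonPair G) :
    mult (f + f') p = mult f p + mult f' p := by
  have := Fintype.ofFinite G
  simp only [mult_eq, finsum_eq_sum_of_fintype, Pi.add_apply, add_mul, Finset.sum_add_distrib,
    mul_add]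

theorem mult_zero (p : MonPair G) : mult (0 : G → ℂ) p = 0 := by
  simp [mult_eq]

theorem mult_neg (f : G → ℂ) (p : MonPair G) : mult (-f) p = - mult f p := by
  simp [mult_eq, finsum_neg_distrib]

theorem conj_val [Finite G] (p : MonPair G) {x : G} (hx : x ∈ p.H) :
    (starRingEnd ℂ) (p.val x) = p.val x⁻¹ := by
  have h1 : p.val x ^ Nat.card G = 1 := by
    have : ∀ n : ℕ, p.val (x ^ n) = p.val x ^ n := by
      intro n
      induction n with
      | zero => simp [val_one]
      | succ n ih => rw [pow_succ, val_mul _ (p.H.pow_mem hx n) hx, ih, pow_succ]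
    rw [← this, pow_card_eq_one', val_one]
  have h2 : ‖p.val x‖ = 1 := Complex.norm_eq_one_of_pow_eq_one h1 Nat.card_pos.ne'
  have h3 : p.val x * p.val x⁻¹ = 1 := by
    rw [← val_mul _ hx (p.H.inv_mem hx), mul_inv_cancel, val_one]
  rw [← Complex.inv_eq_conj h2, inv_eq_of_mul_eq_one_right h3]

variable {V : Type} [AddCommGroup V] [Module ℂ V]

/-- The subspace on which `H` acts through `φ`. -/
def eigen (ρ : G →* Module.End ℂ V) (p : MonPair G) : Submodule ℂ V where
  carrier := {v | ∀ h ∈ p.H, ρ h v = p.val h • v}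
  add_mem' hv hw h hh := by rw [map_add, hv h hh, hw h hh, smul_add]
  zero_mem' h _ := by simp
  smul_mem' c v hv h hh := by rw [map_smul, hv h hh, smul_comm]

theorem mem_eigen {ρ : G →* Module.End ℂ V} {p : MonPair G} {v : V} :
    v ∈ eigen ρ p ↔ ∀ h ∈ p.H, ρ h v = p.val h • v := Iff.rfl

theorem mult_trace [Finite G] [FiniteDimensional ℂ V] (ρ : G →* Module.End ℂ V) (p : MonPair G) :
    mult (fun g => LinearMap.trace ℂ V (ρ g)) p = Module.finrank ℂ (eigen ρ p) := by
  classical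
  have := Fintype.ofFinite G
  have h0 : (Nat.card p.H : ℂ) ≠ 0 := by
    have := card_H_pos p
    exact_mod_cast this.ne'
  let e : Module.End ℂ V := (Nat.card p.H : ℂ)⁻¹ • ∑ x : p.H, p.val (x : G)⁻¹ • ρ x
  have he : LinearMap.IsProj (eigen ρ p) e := by
    constructor
    · intro v
      rw [mem_eigen]
      intro h hh
      simp only [e, LinearMap.smul_apply, LinearMap.sum_apply, map_smul, map_sum]
      rw [smul_comm]
      congr 1
      rw [Finset.smul_sum]
      refine Fintype.sum_equiv (Equiv.mulLeft (⟨h, hh⟩ : p.H)) _ _ fun x => ?_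
      simp only [Equiv.coe_mulLeft, Subgroup.coe_mul, map_mul, Module.End.mul_apply, mul_inv_rev]
      rw [val_mul _ (p.H.inv_mem x.2) (p.H.inv_mem hh), smul_smul, mul_left_comm,
        ← val_mul _ hh (p.H.inv_mem hh), mul_inv_cancel, val_one, mul_one]
    · intro v hv
      simp only [e, LinearMap.smul_apply, LinearMap.sum_apply]
      have : ∀ x : p.H, p.val (x : G)⁻¹ • ρ x v = v := fun x => by
        rw [mem_eigen.1 hv x x.2, smul_smul, ← val_mul _ (p.H.inv_mem x.2) x.2, inv_mul_cancel,
          val_one, one_smul]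
      rw [Finset.sum_congr rfl fun x _ => this x, Finset.sum_const, Finset.card_univ,
        ← Nat.card_eq_fintype_card, ← Nat.cast_smul_eq_nsmul ℂ, smul_smul, inv_mul_cancel₀ h0,
        one_smul]
  rw [← he.trace]
  simp only [mult, schurInner, e, map_smul, map_sum, finsum_eq_sum_of_fintype, smul_eq_mul]
  congr 1
  refine Finset.sum_congr rfl fun x _ => ?_
  rw [← conj_val p x.2, val_of_mem _ x.2, mul_comm]
  rfl

theorem iSup_eigenspace_top [Finite G] [FiniteDimensional ℂ V] (ρ : G →* Module.End ℂ V) (n : G) :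
    ⨆ μ, Module.End.eigenspace (ρ n) μ = ⊤ := by
  apply Module.End.IsSemisimple.iSup_eigenspace_eq_top
  have hN : ((Nat.card G : ℕ) : ℂ) ≠ 0 := by exact_mod_cast (Nat.card_pos (α := G)).ne'
  refine Module.End.isSemisimple_of_squarefree_aeval_eq_zero
    (p := (Polynomial.X ^ Nat.card G - 1 : Polynomial ℂ))
    (Polynomial.X_pow_sub_one_separable_iff.2 hN).squarefree ?_
  rw [map_sub, map_pow, Polynomial.aeval_X, ← map_pow, pow_card_eq_one', map_one, map_one, sub_self]

theorem eigen_of_isExt {ρ : G →* Module.End ℂ V} {p r : MonPair G} {n : G} (h : IsExt p n r) :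
    eigen ρ r = eigen ρ p ⊓ Module.End.eigenspace (ρ n) (r.val n) := by
  have hn : n ∈ r.H := by
    rw [h.2]
    exact Subgroup.mem_sup_right (Subgroup.mem_zpowers n)
  ext v
  rw [Submodule.mem_inf, Module.End.mem_eigenspace_iff]
  constructor
  · intro hv
    exact ⟨fun x hx => by rw [hv x (H_le h.1 hx), h.1 x hx], hv n hn⟩
  · rintro ⟨h1, h2⟩
    let S : Subgroup G :=
      { carrier := {x | x ∈ r.H ∧ ρ x v = r.val x • v}
        mul_mem' := by
          rintro x y ⟨hx, hx'⟩ ⟨hy, hy'⟩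
          refine ⟨r.H.mul_mem hx hy, ?_⟩
          rw [map_mul, Module.End.mul_apply, hy', map_smul, hx', smul_smul, val_mul _ hx hy,
            mul_comm]
        one_mem' := ⟨r.H.one_mem, by simp [val_one]⟩
        inv_mem' := by
          rintro x ⟨hx, hx'⟩
          refine ⟨r.H.inv_mem hx, ?_⟩
          have h3 : r.val x⁻¹ • ρ x v = v := by
            rw [hx', smul_smul, ← val_mul _ (r.H.inv_mem hx) hx, inv_mul_cancel, val_one, one_smul]
          have h4 : ρ x⁻¹ (ρ x v) = v := by
            rw [← Module.End.mul_apply, ← map_mul, inv_mul_cancel, map_one, Module.End.one_apply]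
          nth_rewrite 1 [← h3]
          rw [map_smul, h4] }
    have hS : r.H ≤ S := by
      rw [h.2]
      refine sup_le (fun x hx => ⟨H_le h.1 hx, by rw [h1 x hx, h.1 x hx]⟩) ?_
      rw [Subgroup.zpowers_le]
      exact ⟨hn, h2⟩
    exact fun x hx => (hS hx).2

theorem isExt_ext {p r s : MonPair G} {n : G} (hr : IsExt p n r) (hs : IsExt p n s)
    (h : r.val n = s.val n) : r = s := by
  let S : Subgroup G :=
    { carrier := {x | x ∈ r.H ∧ x ∈ s.H ∧ r.val x = s.val x}
      mul_mem' := by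
        rintro x y ⟨hx, hx', hx''⟩ ⟨hy, hy', hy''⟩
        exact ⟨r.H.mul_mem hx hy, s.H.mul_mem hx' hy', by
          rw [val_mul _ hx hy, val_mul _ hx' hy', hx'', hy'']⟩
      one_mem' := ⟨r.H.one_mem, s.H.one_mem, by rw [val_one, val_one]⟩
      inv_mem' := by
        rintro x ⟨hx, hx', hx''⟩
        refine ⟨r.H.inv_mem hx, s.H.inv_mem hx', ?_⟩
        have h1 : r.val x * r.val x⁻¹ = 1 := by
          rw [← val_mul _ hx (r.H.inv_mem hx), mul_inv_cancel, val_one]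
        have h2 : r.val x * s.val x⁻¹ = 1 := by
          rw [hx'', ← val_mul _ hx' (s.H.inv_mem hx'), mul_inv_cancel, val_one]
        exact mul_left_cancel₀ (val_ne_zero.2 hx) (h1.trans h2.symm) }
  have hrs : r.H = s.H := hr.2.trans hs.2.symm
  have hS : s.H ≤ S := by
    have hn : n ∈ s.H := by
      rw [hs.2]
      exact Subgroup.mem_sup_right (Subgroup.mem_zpowers n)
    nth_rewrite 1 [hs.2]
    refine sup_le (fun x hx => ⟨H_le hr.1 hx, H_le hs.1 hx, by rw [hr.1 x hx, hs.1 x hx]⟩) ?_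
    rw [Subgroup.zpowers_le]
    exact ⟨hrs ▸ hn, hn, h⟩
  exact eq_of_le (fun x hx => (hS (hrs ▸ hx)).2.2.symm) hrs.ge

theorem exists_isExt {ρ : G →* Module.End ℂ V} {p : MonPair G} {n : G} {μ : ℂ} {v : V}
    (hv : v ≠ 0) (h1 : v ∈ eigen ρ p) (h2 : ρ n v = μ • v) : ∃ r, IsExt p n r ∧ r.val n = μ := by
  let S : Subgroup G :=
    { carrier := {x | ∃ c : ℂˣ, ρ x v = (c : ℂ) • v}
      mul_mem' := by
        rintro x y ⟨c, hc⟩ ⟨d, hd⟩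
        exact ⟨c * d, by
          rw [map_mul, Module.End.mul_apply, hd, map_smul, hc, smul_smul, Units.val_mul, mul_comm]⟩
      one_mem' := ⟨1, by simp⟩
      inv_mem' := by
        rintro x ⟨c, hc⟩
        refine ⟨c⁻¹, ?_⟩
        have h3 : ((c⁻¹ : ℂˣ) : ℂ) • ρ x v = v := by rw [hc, smul_smul, Units.inv_mul, one_smul]
        have h4 : ρ x⁻¹ (ρ x v) = v := by
          rw [← Module.End.mul_apply, ← map_mul, inv_mul_cancel, map_one, Module.End.one_apply]
        nth_rewrite 1 [← h3]
        rw [map_smul, h4] }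
  have hS : ∀ x : S, ∃ c : ℂˣ, ρ x v = (c : ℂ) • v := fun x => x.2
  choose c hc using hS
  have huniq : ∀ a b : ℂ, a • v = b • v → a = b := fun a b hab => smul_left_injective ℂ hv hab
  let q : MonPair G :=
    { H := S
      φ :=
        { toFun := c
          map_one' := Units.ext (huniq _ _ (by rw [← hc]; simp))
          map_mul' := fun x y => Units.ext (huniq _ _ (by
            rw [← hc, Subgroup.coe_mul, map_mul, Module.End.mul_apply, hc, map_smul, hc, smul_smul,
              Units.val_mul, mul_comm])) } }
  have hq : ∀ x ∈ q.H, ρ x v = q.val x • v := fun x hx => by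
    rw [val_of_mem _ hx]
    exact hc ⟨x, hx⟩
  have hpq : p.H ≤ q.H := fun x hx => ⟨p.φ ⟨x, hx⟩, by rw [h1 x hx, val_of_mem _ hx]⟩
  have hμ : μ ≠ 0 := by
    rintro rfl
    apply hv
    have h4 : ρ n⁻¹ (ρ n v) = v := by
      rw [← Module.End.mul_apply, ← map_mul, inv_mul_cancel, map_one, Module.End.one_apply]
    rw [← h4, h2, zero_smul, map_zero]
  have hnq : n ∈ q.H := ⟨Units.mk0 μ hμ, h2⟩
  obtain ⟨r, hr, hrq⟩ := exists_isExt_le.2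
    (⟨fun x hx => huniq _ _ (by rw [← hq x (hpq hx), h1 x hx]), hnq⟩ : p ≤ q ∧ n ∈ q.H)
  refine ⟨r, hr, huniq _ _ ?_⟩
  have hn : n ∈ r.H := by
    rw [hr.2]
    exact Subgroup.mem_sup_right (Subgroup.mem_zpowers n)
  rw [← hrq n hn, ← hq n hnq, h2]

open Classical in
theorem sum_eigen [Fintype G] [Fintype (MonPair G)] [FiniteDimensional ℂ V]
    (ρ : G →* Module.End ℂ V) (p : MonPair G) (n : MulAction.stabilizer G p) :
    ∑ r : MonPair G with IsExt p n r, Module.finrank ℂ (eigen ρ r) =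
      Module.finrank ℂ (eigen ρ p) := by
  have hinv : ∀ v ∈ eigen ρ p, ρ (n : G) v ∈ eigen ρ p := by
    intro v hv h hh
    have hs : (n : G) • p = p := n.2
    have h1 : (n : G)⁻¹ * h * n ∈ p.H := by
      rw [← mem_smul, hs]
      exact hh
    have h2 : p.val ((n : G)⁻¹ * h * n) = p.val h := by rw [← smul_val, hs]
    have h3 : h * (n : G) = n * ((n : G)⁻¹ * h * n) := by group
    rw [← Module.End.mul_apply, ← map_mul, h3, map_mul, Module.End.mul_apply, hv _ h1, h2, map_smul]
  let N : {r : MonPair G // IsExt p n r} → Submodule ℂ V := fun r => eigen ρ r.1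
  have hind : iSupIndep N := by
    have h1 : iSupIndep fun r : {r : MonPair G // IsExt p n r} =>
        Module.End.eigenspace (ρ (n : G)) (r.1.val n) :=
      (Module.End.eigenspaces_iSupIndep (ρ (n : G))).comp
        (fun r s h => Subtype.ext (isExt_ext r.2 s.2 h))
    refine h1.mono fun r => ?_
    rw [show N r = _ from eigen_of_isExt r.2]
    exact inf_le_right
  have hsup : ⨆ r, N r = eigen ρ p := by
    apply le_antisymm
    · refine iSup_le fun r => ?_
      rw [show N r = _ from eigen_of_isExt r.2]
      exact inf_le_left
    · have h2 := Submodule.inf_iSup_genEigenspace (f := ρ (n : G)) (p := eigen ρ p) hinv 1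
      have h3 : eigen ρ p ⊓ ⨆ μ, Module.End.eigenspace (ρ (n : G)) μ = eigen ρ p := by
        rw [iSup_eigenspace_top, inf_top_eq]
      rw [← h3]
      refine h2.le.trans (iSup_le fun μ => ?_)
      intro v hv
      by_cases hv0 : v = 0
      · rw [hv0]
        exact Submodule.zero_mem _
      · have hv2 : ρ (n : G) v = μ • v := Module.End.mem_eigenspace_iff.1 hv.2
        obtain ⟨r, hr, hrn⟩ := exists_isExt hv0 hv.1 hv2
        refine Submodule.mem_iSup_of_mem ⟨r, hr⟩ ?_
        rw [show N ⟨r, hr⟩ = _ from eigen_of_isExt hr, hrn]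
        exact ⟨hv.1, Module.End.mem_eigenspace_iff.2 hv2⟩
  have he : Module.finrank ℂ (⨆ r, N r : Submodule ℂ V) = ∑ r, Module.finrank ℂ (N r) := by
    rw [Submodule.iSup_eq_range_dfinsupp_lsum,
      ← (LinearEquiv.ofInjective _ hind.dfinsupp_lsum_injective).finrank_eq]
    exact Module.finrank_directSum (R := ℂ) fun r => N r
  rw [← hsup, he]
  rw [← Finset.sum_subtype (p := IsExt p n) (f := fun r => Module.finrank ℂ (eigen ρ r))]
  simp

open Classical in
theorem exists_int [Fintype G] [Fintype (MonPair G)] (f : G → ℂ) (hf : f ∈ CharRing G) :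
    ∃ x : MonPair G → ℚ, (∀ p, (x p : ℂ) = mult f p) ∧ Cong x ∧ ∀ (g : G) p, x (g • p) = x p := by
  induction hf using AddSubgroup.closure_induction with
  | mem f hf =>
    obtain ⟨d, X, rfl⟩ := hf
    let ρ : G →* Module.End ℂ (Fin d → ℂ) :=
      ((Matrix.toLinAlgEquiv' : Matrix (Fin d) (Fin d) ℂ ≃ₐ[ℂ] _) :
        Matrix (Fin d) (Fin d) ℂ →* Module.End ℂ (Fin d → ℂ)).comp ((Units.coeHom _).comp X)
    have hρ : charOf X = fun g => LinearMap.trace ℂ _ (ρ g) := by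
      ext g
      exact (Matrix.trace_toLin'_eq _).symm
    have hm : ∀ p, ((Module.finrank ℂ (eigen ρ p) : ℚ) : ℂ) = mult (charOf X) p := fun p => by
      rw [hρ, mult_trace]
      simp
    refine ⟨fun p => Module.finrank ℂ (eigen ρ p), hm, fun p => ?_, fun g p => ?_⟩
    · refine ⟨Module.finrank ℂ (eigen ρ p), ?_⟩
      simp only [← Nat.cast_sum, sum_eigen]
      rw [Finset.sum_const, Finset.card_univ, ← Nat.card_eq_fintype_card, smul_eq_mul]
      push_cast
      rfl
    · have h1 : mult (charOf X) (g • p) = mult (charOf X) p := by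
        refine mult_smul _ (fun g x => ?_) g p
        unfold charOf
        rw [map_mul, map_mul, mul_assoc, Units.val_mul, Matrix.trace_mul_comm, ← Units.val_mul]
        simp
      rw [← hm, ← hm] at h1
      change (Module.finrank ℂ (eigen ρ (g • p)) : ℚ) = (Module.finrank ℂ (eigen ρ p) : ℚ)
      exact_mod_cast h1
  | zero => exact ⟨fun _ => 0, fun p => by simp [mult_zero], Cong.zero, fun _ _ => rfl⟩
  | add f g _ _ hf hg =>
    obtain ⟨x, hx1, hx2, hx3⟩ := hf
    obtain ⟨y, hy1, hy2, hy3⟩ := hg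
    exact ⟨fun p => x p + y p, fun p => by rw [mult_add, ← hx1, ← hy1]; push_cast; rfl,
      hx2.add hy2, fun g p => by simp only [hx3, hy3]⟩
  | neg f _ hf =>
    obtain ⟨x, hx1, hx2, hx3⟩ := hf
    exact ⟨fun p => - x p, fun p => by rw [mult_neg, ← hx1]; push_cast; rfl,
      hx2.neg, fun g p => by simp only [hx3]⟩

theorem exists_mark [Finite G] (f : CharRing G) :
    ∃ b : RPlus G, ∀ p, ((mark p b : ℚ) : ℂ) = mult f.1 p := by
  have := Fintype.ofFinite G
  have := Fintype.ofFinite (MonPair G)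
  obtain ⟨x, hx1, hx2, hx3⟩ := exists_int f.1 f.2
  obtain ⟨b, hb⟩ := exists_of_cong hx3 hx2
  exact ⟨b, fun p => by rw [hb, hx1]⟩

theorem eq_of_mark [Finite G] {b b' : RPlus G}
    (h : ∀ p, ((mark p b : ℚ) : ℂ) = ((mark p b' : ℚ) : ℂ)) : b = b' := by
  rw [← sub_eq_zero]
  refine mark_injective fun p => ?_
  rw [map_sub, sub_eq_zero]
  exact_mod_cast h p

theorem weight_ofChar [Finite G] (φ : G →* ℂˣ) (q : MonPair G) [Decidable (cls q = cls (ofChar φ))] :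
    weight (ofChar φ) q = if cls q = cls (ofChar φ) then 1 else 0 := by
  have hc : Nat.card q.H ≤ Nat.card (ofChar φ).H := by
    rw [show (ofChar φ).H = ⊤ from rfl, Subgroup.card_top]
    exact Subgroup.card_le_card_group _
  split_ifs with h
  · obtain ⟨g, rfl⟩ := cls_eq_cls.1 h
    have h1 : MulAction.stabilizer G (ofChar φ) = ⊤ :=
      top_le_iff.1 fun g _ => smul_self_of_mem (ofChar φ) (Subgroup.mem_top g)
    rw [weight_smul_right, weight_self, h1, show (ofChar φ).H = ⊤ from rfl, div_self]
    have : 0 < Nat.card (⊤ : Subgroup G) := Nat.card_pos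
    positivity
  · exact weight_eq_zero hc (fun h' => h h'.symm)

theorem mark_ofChar [Finite G] (φ : G →* ℂˣ) (b : RPlus G) :
    mark (ofChar φ) b = b (cls (ofChar φ)) := by
  classical
  rw [mark_eq_sum]
  simp only [weight_ofChar, cls_out]
  by_cases h : b (cls (ofChar φ)) = 0
  · simp [h]
  · simp
    exact fun h' => absurd h' h

theorem mult_ofChar (φ : G →* ℂˣ) (f : G → ℂ) : mult f (ofChar φ) = schurInner f (linChar φ) := by
  rw [mult_eq, schurInner, show (ofChar φ).H = ⊤ from rfl, Subgroup.card_top]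
  congr 1
  refine finsum_congr fun x => ?_
  rw [val_of_mem _ (show x ∈ (ofChar φ).H from Subgroup.mem_top x)]
  rfl

theorem map_ofChar (p : MonPair G) : (ofChar p.φ : MonPair p.H).map = p := by
  refine ext_val fun x => ?_
  by_cases hx : x ∈ p.H
  · refine (map_val (ofChar p.φ) ⟨x, hx⟩).trans ?_
    rw [val_of_mem p hx, val_of_mem (ofChar p.φ) (x := ⟨x, hx⟩) (Subgroup.mem_top _)]
    rfl
  · rw [val_of_not_mem p hx, val_of_not_mem]
    rintro ⟨y, _, rfl⟩
    exact hx y.2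

end Multiplicities

end MonPair

/-- The marks of a canonical collection are multiplicities. -/
theorem IsCanonical.mark_eq {a : ∀ (G : Type u) [Group G] [Finite G], CharRing G →+ RPlus G}
    (ha : IsCanonical a) (G : Type u) [Group G] [Finite G] (χ : CharRing G) (p : MonPair G) :
    ((mark p (a G χ) : ℚ) : ℂ) = mult χ.1 p := by
  nth_rewrite 1 [← map_ofChar p]
  rw [← mark_res, ha.res_comm, mark_ofChar]
  have := ha.normalized p.H (CharRing.res p.H χ) p.φ
  push_cast
  rw [this]
  rfl

theorem existsUnique_isCanonical :
    ∃! a : ∀ (G : Type u) [Group G] [Finite G], CharRing G →+ RPlus G, IsCanonical a := by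
  have key : ∀ (G : Type u) [Group G] [Finite G], ∃ a : CharRing G →+ RPlus G,
      ∀ χ p, ((mark p (a χ) : ℚ) : ℂ) = mult χ.1 p := by
    intro G _ _
    choose a ha using fun χ : CharRing G => exists_mark χ
    refine ⟨⟨⟨a, ?_⟩, ?_⟩, ha⟩
    · refine eq_of_mark fun p => ?_
      rw [ha, map_zero]
      simpa using mult_zero p
    · intro χ ψ
      refine eq_of_mark fun p => ?_
      change ((mark p (a (χ + ψ)) : ℚ) : ℂ) = ((mark p (a χ + a ψ) : ℚ) : ℂ)
      rw [map_add, ha]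
      push_cast
      rw [ha, ha]
      exact mult_add _ _ p
  choose a ha using key
  refine ⟨fun G _ _ => a G, ⟨fun G _ _ U χ => eq_of_mark fun p => ?_, fun G _ _ χ φ => ?_⟩, ?_⟩
  · rw [mark_res, ha, ha]
    exact (mult_map χ.1 p).symm
  · have h1 := ha G χ (ofChar φ)
    rw [mark_ofChar, mult_ofChar] at h1
    exact_mod_cast h1
  · intro a' ha'
    funext G _ _
    refine AddMonoidHom.ext fun χ => eq_of_mark fun p => ?_
    rw [ha'.mark_eq, ha]

end Existence

/-- The canonical Brauer induction formula: the unique canonical collection `a_G`. -/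
noncomputable def canonicalInduction :
    ∀ (G : Type u) [Group G] [Finite G], CharRing G →+ RPlus G :=
  Classical.choose existsUnique_isCanonical.exists

theorem isCanonical_canonicalInduction : IsCanonical canonicalInduction.{u} :=
  Classical.choose_spec existsUnique_isCanonical.exists

/-- The coefficient `α_{[H, φ]_G}(χ)` of the canonical Brauer induction formula. -/
noncomputable def coeff {G : Type u} [Group G] [Finite G] (χ : CharRing G)
    (c : MonPair.Cls G) : ℤ :=
  canonicalInduction G χ c

open Classical in
/-- `S(G, χ, n)`: the sum of the coefficients `α_{[H, φ]_G}(χ)` over all `[H, φ]_G` with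
`n ∣ o(φ)`. -/
noncomputable def invS {G : Type u} [Group G] [Finite G] (χ : CharRing G) (n : ℕ) : ℤ :=
  ∑ᶠ c : MonPair.Cls G, if n ∣ MonPair.clsOrder c then coeff χ c else 0

open Classical in
/-- The `π`-part `m_π` of a positive integer `m`, for a set `π` of primes. -/
noncomputable def piPart (π : Set ℕ) (m : ℕ) : ℕ :=
  ∏ p ∈ m.primeFactors with p ∈ π, p ^ m.factorization p

/-- The quotient of `n` by the product of its prime divisors. -/
def underline (n : ℕ) : ℕ := n / ∏ p ∈ n.primeFactors, p

/-- `n(ρ) = N_{ρ'} * (underline n)_ρ`, where `ρ'` is the complement of `ρ`. -/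
noncomputable def nRho (N n : ℕ) (ρ : Finset ℕ) : ℕ :=
  piPart (ρ : Set ℕ)ᶜ N * piPart (ρ : Set ℕ) (underline n)

end BrauerInduction

namespace BrauerInduction

/-! ### The divisibility pattern of the integers n(ρ) -/

section Arithmetic

/-! By `IsCanonical.mark_eq` the marks of a_G(χ) are the multiplicities (χ|_H, φ), and the marks at
pairs over cyclic subgroups suffice here. The eigenvalues of 𝒳(g) correspond to characters of ⟨g⟩,
so χ(g^m) is the sum of p(g)^m over the pairs p on ⟨g⟩, weighted by these marks
(`trace_pow_eq_sum`). Averaging over g and using orthogonality for φ^m on the conjugates of H, a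
class [H, φ] contributes 1 if o(φ) ∣ m and 0 otherwise (`sum_val_pow_mul_weight`). Hence (Ψ^m χ, 1)
is the sum of the α_[H,φ](χ) with o(φ) ∣ m (`sum_coeff_eq_schurInner`).

Let N = exp(G). For o ∣ N, the condition o ∣ n(ρ) says v_p(o) < v_p(n) for every p in ρ. So the
alternating sum over ρ of these indicators factors over the primes p ∣ n, and equals 1 if n ∣ o and
0 otherwise (`sum_powerset_dvd_nRho`). This is (a).

For (b) the sign is read off from the right side of (a). Since g ↦ g^k permutes G for k prime to N,
every eigenvalue there may be replaced by the average of its conjugates, which is μ(r)/φ(r) for a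
root of unity of order r. This is multiplicative in r, so an eigenvalue of order o contributes a
product over p ∣ n of factors 1 − μ(p^e)/φ(p^e) with e = max(0, v_p(o) − v_p(n) + 1). Such a factor
is 0 if e = 0 and at least 1 if e > 0. Thus |G| S(G, χ, n) is a sum of nonnegative terms
(`card_mul_invS`), and it is positive exactly when some 𝒳(g) has an eigenvalue of order divisible by
n; a power of g then has an eigenvalue of order exactly n.

The remaining link in (c) is between characters and eigenvalues: φ has cyclic image, hence a value
of order o(φ), and conversely ⟨x⟩ acts on an eigenvector of 𝒳(x) through a character whose order is
that of the eigenvalue. -/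

theorem factorization_piPart (π : Set ℕ) (m p : ℕ) [Decidable (p ∈ π)] :
    (piPart π m).factorization p = if p ∈ π then m.factorization p else 0 := by
  classical
  have h0 : ∀ q ∈ m.primeFactors.filter (· ∈ π), q ^ m.factorization q ≠ 0 := fun q hq =>
    pow_ne_zero _ (Nat.prime_of_mem_primeFactors (Finset.mem_filter.1 hq).1).ne_zero
  unfold piPart
  rw [Nat.factorization_prod_apply h0]
  have h1 : ∀ q ∈ m.primeFactors.filter (· ∈ π), (q ^ m.factorization q).factorization p =
      if q = p then m.factorization p else 0 := by
    intro q hq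
    rw [(Nat.prime_of_mem_primeFactors (Finset.mem_filter.1 hq).1).factorization_pow,
      Finsupp.single_apply]
    split_ifs with h
    · rw [h]
    · rfl
  rw [Finset.sum_congr rfl h1, Finset.sum_ite_eq']
  by_cases hp : p ∈ m.primeFactors
  · simp only [Finset.mem_filter, hp, true_and]
  · have : m.factorization p = 0 := by
      rwa [← Finsupp.notMem_support_iff, Nat.support_factorization]
    simp [this]

open Classical in
theorem piPart_ne_zero (π : Set ℕ) (m : ℕ) : piPart π m ≠ 0 :=
  Finset.prod_ne_zero_iff.2 fun _ hq =>
    pow_ne_zero _ (Nat.prime_of_mem_primeFactors (Finset.mem_filter.1 hq).1).ne_zero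

/-- Truncated subtraction covers the primes not dividing n, where both sides are 0. -/
theorem factorization_underline {n : ℕ} (p : ℕ) :
    (underline n).factorization p = n.factorization p - 1 := by
  unfold underline
  rw [Nat.factorization_div (Nat.prod_primeFactors_dvd n), Finsupp.tsub_apply,
    Nat.factorization_prod_apply fun q hq => (Nat.prime_of_mem_primeFactors hq).ne_zero]
  have h1 : ∀ q ∈ n.primeFactors, q.factorization p = if q = p then 1 else 0 := fun q hq => by
    rw [(Nat.prime_of_mem_primeFactors hq).factorization, Finsupp.single_apply]
  rw [Finset.sum_congr rfl h1, Finset.sum_ite_eq']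
  split_ifs with hp
  · rfl
  · have : n.factorization p = 0 := by
      rwa [← Finsupp.notMem_support_iff, Nat.support_factorization]
    simp [this]

theorem nRho_ne_zero (N n : ℕ) (ρ : Finset ℕ) : nRho N n ρ ≠ 0 :=
  mul_ne_zero (piPart_ne_zero _ _) (piPart_ne_zero _ _)

/-- The two factors of n(ρ) are supported on complementary sets of primes, so only one of them
contributes at p. -/
theorem factorization_nRho (N n : ℕ) (ρ : Finset ℕ) (p : ℕ) :
    (nRho N n ρ).factorization p =
      if p ∈ ρ then n.factorization p - 1 else N.factorization p := by
  classical
  unfold nRho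
  rw [Nat.factorization_mul (piPart_ne_zero _ _) (piPart_ne_zero _ _), Finsupp.add_apply,
    factorization_piPart, factorization_piPart, factorization_underline]
  by_cases hp : p ∈ ρ <;> simp [hp]

/-- Outside ρ the integer n(ρ) has the full exponent of N, so o ∣ N leaves no condition there. At p
in ρ the condition is v_p(o) ≤ v_p(n) − 1, which is the strict inequality because p divides n. -/
theorem dvd_nRho_iff {N n o : ℕ} (hN : N ≠ 0) (ho : o ∣ N) {ρ : Finset ℕ}
    (hρ : ρ ⊆ n.primeFactors) :
    o ∣ nRho N n ρ ↔ ∀ p ∈ ρ, o.factorization p < n.factorization p := by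
  have ho0 : o ≠ 0 := ne_zero_of_dvd_ne_zero hN ho
  rw [← Nat.factorization_le_iff_dvd ho0 (nRho_ne_zero N n ρ)]
  have hle := (Nat.factorization_le_iff_dvd ho0 hN).2 ho
  have hpos : ∀ p ∈ ρ, 0 < n.factorization p := fun p hp => by
    rw [Nat.pos_iff_ne_zero, ← Finsupp.mem_support_iff, Nat.support_factorization]
    exact hρ hp
  constructor
  · intro h p hp
    have h1 := h p
    rw [factorization_nRho, if_pos hp] at h1
    have := hpos p hp
    omega
  · intro h p
    rw [factorization_nRho]
    split_ifs with hp
    · have := h p hp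
      omega
    · exact hle p

/-- The local condition is phrased as the negation of the one in `dvd_nRho_iff`, so that the two
indicators at p add up to 1. -/
theorem dvd_iff_forall_primeFactors {n o : ℕ} (hn : n ≠ 0) (ho : o ≠ 0) :
    n ∣ o ↔ ∀ p ∈ n.primeFactors, ¬ o.factorization p < n.factorization p := by
  rw [← Nat.factorization_le_iff_dvd hn ho]
  simp only [not_lt]
  refine ⟨fun h p _ => h p, fun h p => ?_⟩
  by_cases hp : p ∈ n.primeFactors
  · exact h p hp
  · rw [← Nat.support_factorization, Finsupp.notMem_support_iff] at hp
    rw [hp]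
    exact Nat.zero_le _

/-- Applied twice: to the indicators of v_p(o) < v_p(n) for the formula in (a), and to averages of
roots of unity for the sign in (b). -/
theorem sum_powerset_neg_one_mul_prod {R : Type*} [CommRing R] (s : Finset ℕ) (f : ℕ → R) :
    ∑ ρ ∈ s.powerset, (-1) ^ ρ.card * ∏ p ∈ ρ, f p = ∏ p ∈ s, (1 - f p) := by
  rw [Finset.prod_sub]
  simp

/-- Inclusion-exclusion: the integers `n(ρ)` detect divisibility by `n`. -/
theorem sum_powerset_dvd_nRho {N n o : ℕ} (hN : N ≠ 0) (hn : n ∣ N) (ho : o ∣ N) :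
    ∑ ρ ∈ n.primeFactors.powerset, (-1 : ℂ) ^ ρ.card * (if o ∣ nRho N n ρ then 1 else 0) =
      if n ∣ o then 1 else 0 := by
  -- The indicator of o ∣ n(ρ) is a product of local indicators over ρ, which turns the alternating
  -- sum into a product over the primes dividing n.
  have h1 : ∀ ρ ∈ n.primeFactors.powerset,
      (-1 : ℂ) ^ ρ.card * (if o ∣ nRho N n ρ then 1 else 0) = (-1) ^ ρ.card *
        ∏ p ∈ ρ, if o.factorization p < n.factorization p then (1 : ℂ) else 0 := by
    intro ρ hρ
    rw [Finset.prod_ite_zero]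
    simp only [dvd_nRho_iff hN ho (Finset.mem_powerset.1 hρ), Finset.prod_const_one]
  rw [Finset.sum_congr rfl h1, sum_powerset_neg_one_mul_prod]
  have h2 : ∀ p ∈ n.primeFactors, (1 - if o.factorization p < n.factorization p then (1 : ℂ) else 0)
      = if ¬ o.factorization p < n.factorization p then 1 else 0 := by
    intro p _
    split_ifs <;> simp
  rw [Finset.prod_congr rfl h2, Finset.prod_ite_zero]
  simp only [dvd_iff_forall_primeFactors (ne_zero_of_dvd_ne_zero hN hn)
    (ne_zero_of_dvd_ne_zero hN ho), Finset.prod_const_one]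

/-! ### Averages of roots of unity over their conjugates -/

open ArithmeticFunction in
-- Möbius inversion: the m-th roots of unity split into primitive d-th roots for d ∣ m, and their
-- total is 1 for m = 1 and 0 for m > 1, by the geometric sum.
theorem sum_primitiveRoots {r : ℕ} (hr : 0 < r) : ∑ η ∈ primitiveRoots r ℂ, η = (moebius r : ℂ) := by
  classical
  have key := (sum_eq_iff_sum_mul_moebius_eq (R := ℂ) (f := fun r => ∑ η ∈ primitiveRoots r ℂ, η)
    (g := fun r => if r = 1 then 1 else 0)).1 (fun m hm => by
      rw [← Finset.sum_biUnion, ← IsPrimitiveRoot.nthRoots_one_eq_biUnion_primitiveRoots]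
      · obtain ⟨z, hζ⟩ : ∃ z : ℂ, IsPrimitiveRoot z m := ⟨_, Complex.isPrimitiveRoot_exp m hm.ne'⟩
        trans ∑ i ∈ Finset.range m, z ^ i
        · symm
          refine Finset.sum_bij (fun i _ => z ^ i) ?_ ?_ ?_ ?_
          · intro i _
            rw [Polynomial.mem_nthRootsFinset hm, ← pow_mul, mul_comm, pow_mul, hζ.pow_eq_one,
              one_pow]
          · intro i hi j hj hij
            exact hζ.pow_inj (Finset.mem_range.1 hi) (Finset.mem_range.1 hj) hij
          · intro η hη
            rw [Polynomial.mem_nthRootsFinset hm] at hη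
            have : NeZero m := ⟨hm.ne'⟩
            obtain ⟨i, hi, h⟩ := hζ.eq_pow_of_pow_eq_one hη
            exact ⟨i, Finset.mem_range.2 hi, h⟩
          · intro i _
            rfl
        · split_ifs with h1
          · subst h1
            simp
          · exact hζ.geom_sum_eq_zero (by omega)
      · intro i _ j _ hij
        exact IsPrimitiveRoot.disjoint hij) r hr
  rw [← key, Finset.sum_eq_single (r, 1)]
  · simp
  · rintro ⟨a, b⟩ hab hne
    rw [Nat.mem_divisorsAntidiagonal] at hab
    rw [if_neg, mul_zero]
    rintro rfl
    exact hne (by rw [← hab.1, mul_one])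
  · intro h
    exact absurd (Nat.mem_divisorsAntidiagonal.2 ⟨mul_one r, hr.ne'⟩) h

theorem pow_eq_pow_of_modEq_of_pow_eq_one {m a b : ℕ} {ξ : ℂ} (hξ : ξ ^ m = 1)
    (h : a ≡ b [MOD m]) : ξ ^ a = ξ ^ b := by
  rw [← pow_mod_orderOf ξ a, ← pow_mod_orderOf ξ b,
    show a % orderOf ξ = b % orderOf ξ from h.of_dvd (orderOf_dvd_of_pow_eq_one hξ)]

theorem pow_zmod_val_mul {N : ℕ} {ξ : ℂ} (hξ : ξ ^ N = 1) (a b : ZMod N) :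
    ξ ^ (a * b).val = (ξ ^ a.val) ^ b.val := by
  rw [← pow_mul, ZMod.val_mul]
  exact pow_eq_pow_of_modEq_of_pow_eq_one hξ (Nat.mod_modEq _ _)

open ArithmeticFunction in
/-- The sum of the conjugates `ξ ^ k`, with `k` running through the units modulo `N`. -/
theorem totient_mul_sum_units_pow {N : ℕ} [NeZero N] {ξ : ℂ} (hξ : ξ ^ N = 1) :
    (Nat.totient (orderOf ξ) : ℂ) * ∑ k : (ZMod N)ˣ, ξ ^ (k : ZMod N).val =
      Nat.totient N * (moebius (orderOf ξ) : ℂ) := by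
  have hrN : orderOf ξ ∣ N := orderOf_dvd_of_pow_eq_one hξ
  have hr : 0 < orderOf ξ := Nat.pos_of_dvd_of_pos hrN (NeZero.pos N)
  -- Write η = ξ^i with i prime to the order of ξ. Units lift along ZMod N → ZMod (order of ξ), so i
  -- comes from a unit u modulo N, and k ↦ uk reindexes the sum.
  have h1 : ∀ η ∈ primitiveRoots (orderOf ξ) ℂ,
      ∑ k : (ZMod N)ˣ, η ^ (k : ZMod N).val = ∑ k : (ZMod N)ˣ, ξ ^ (k : ZMod N).val := by
    intro η hη
    have hp := (mem_primitiveRoots hr).1 hη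
    have : NeZero (orderOf ξ) := ⟨hr.ne'⟩
    obtain ⟨i, hi, hco, rfl⟩ := (IsPrimitiveRoot.orderOf ξ).isPrimitiveRoot_iff.1 hp
    obtain ⟨u, hu⟩ := ZMod.unitsMap_surjective hrN (ZMod.unitOfCoprime i hco)
    have hui : ξ ^ (u : ZMod N).val = ξ ^ i := by
      refine pow_eq_pow_of_modEq_of_pow_eq_one (pow_orderOf_eq_one ξ) ?_
      rw [← ZMod.natCast_eq_natCast_iff]
      have := congrArg Units.val hu
      rw [ZMod.unitsMap_val, ZMod.coe_unitOfCoprime] at this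
      rw [← this, ZMod.natCast_val]
    refine Fintype.sum_equiv (Equiv.mulLeft u) _ _ fun k => ?_
    rw [Equiv.coe_mulLeft, Units.val_mul, pow_zmod_val_mul hξ, hui]
  -- Raising to the k-th power permutes the primitive roots of a given order dividing N, with the
  -- power k⁻¹ as inverse.
  have h2 : ∀ k : (ZMod N)ˣ, ∑ η ∈ primitiveRoots (orderOf ξ) ℂ, η ^ (k : ZMod N).val =
      ∑ η ∈ primitiveRoots (orderOf ξ) ℂ, η := by
    intro k
    have hpow : ∀ (l : (ZMod N)ˣ), ∀ η ∈ primitiveRoots (orderOf ξ) ℂ,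
        η ^ (l : ZMod N).val ∈ primitiveRoots (orderOf ξ) ℂ := by
      intro l η hη
      rw [mem_primitiveRoots hr] at hη ⊢
      exact hη.pow_of_coprime _ ((ZMod.val_coe_unit_coprime l).coprime_dvd_right hrN)
    have hinv : ∀ (l : (ZMod N)ˣ), ∀ η ∈ primitiveRoots (orderOf ξ) ℂ,
        (η ^ (l : ZMod N).val) ^ ((l⁻¹ : (ZMod N)ˣ) : ZMod N).val = η := by
      intro l η hη
      rw [mem_primitiveRoots hr] at hη
      have hN : η ^ N = 1 := (hη.pow_eq_one_iff_dvd N).2 hrN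
      rw [← pow_zmod_val_mul hN, ← Units.val_mul, mul_inv_cancel, Units.val_one]
      nth_rewrite 2 [← pow_one η]
      refine pow_eq_pow_of_modEq_of_pow_eq_one hN ?_
      rw [← ZMod.natCast_eq_natCast_iff]
      simp
    refine Finset.sum_bij' (fun η _ => η ^ (k : ZMod N).val)
      (fun η _ => η ^ ((k⁻¹ : (ZMod N)ˣ) : ZMod N).val) (hpow k) (hpow k⁻¹) (hinv k) ?_
      (fun _ _ => rfl)
    intro η hη
    simpa using hinv k⁻¹ η hη
  -- The sum of η^k over all pairs (η, k) is counted in two ways: for fixed η it does not depend on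
  -- η, and for fixed k it is the Möbius value.
  calc (Nat.totient (orderOf ξ) : ℂ) * ∑ k : (ZMod N)ˣ, ξ ^ (k : ZMod N).val
      = ∑ η ∈ primitiveRoots (orderOf ξ) ℂ, ∑ k : (ZMod N)ˣ, η ^ (k : ZMod N).val := by
        rw [Finset.sum_congr rfl h1, Finset.sum_const,
          (IsPrimitiveRoot.orderOf ξ).card_primitiveRoots, nsmul_eq_mul]
    _ = _ := by
        rw [Finset.sum_comm, Finset.sum_congr rfl fun k _ => h2 k, Finset.sum_const,
          sum_primitiveRoots hr, Finset.card_univ, ZMod.card_units_eq_totient, nsmul_eq_mul]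

/-- The average of the primitive `r`-th roots of unity. -/
noncomputable def rootAverage (r : ℕ) : ℚ := (ArithmeticFunction.moebius r : ℚ) / r.totient

theorem sum_units_pow {N : ℕ} [NeZero N] {ξ : ℂ} (hξ : ξ ^ N = 1) :
    ∑ k : (ZMod N)ˣ, ξ ^ (k : ZMod N).val = N.totient * (rootAverage (orderOf ξ) : ℂ) := by
  have h := totient_mul_sum_units_pow hξ
  have hr : 0 < (orderOf ξ).totient :=
    Nat.totient_pos.2 (Nat.pos_of_dvd_of_pos (orderOf_dvd_of_pow_eq_one hξ) (NeZero.pos N))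
  have hr' : ((orderOf ξ).totient : ℂ) ≠ 0 := by exact_mod_cast hr.ne'
  unfold rootAverage
  push_cast
  rw [← mul_div_assoc, eq_div_iff hr', mul_comm, h]

theorem rootAverage_mul {a b : ℕ} (h : a.Coprime b) :
    rootAverage (a * b) = rootAverage a * rootAverage b := by
  unfold rootAverage
  rw [ArithmeticFunction.isMultiplicative_moebius.map_mul_of_coprime h, Nat.totient_mul h]
  push_cast
  rw [div_mul_div_comm]

theorem rootAverage_one : rootAverage 1 = 1 := by simp [rootAverage]

theorem rootAverage_prod_prime_pow (s : Finset ℕ) (hs : ∀ p ∈ s, p.Prime) (f : ℕ → ℕ) :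
    rootAverage (∏ p ∈ s, p ^ f p) = ∏ p ∈ s, rootAverage (p ^ f p) := by
  induction s using Finset.induction_on with
  | empty => simp [rootAverage_one]
  | insert q s hq ih =>
    rw [Finset.prod_insert hq, Finset.prod_insert hq, rootAverage_mul,
      ih fun p hp => hs p (Finset.mem_insert_of_mem hp)]
    refine Nat.Coprime.prod_right fun p hp => Nat.coprime_pow_primes _ _
      (hs q (Finset.mem_insert_self q s)) (hs p (Finset.mem_insert_of_mem hp)) ?_
    rintro rfl
    exact hq hp

/-- The source of positivity: μ(p^k) is −1 for k = 1 and 0 for k > 1. -/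
theorem rootAverage_prime_pow_nonpos {p k : ℕ} (hp : p.Prime) (hk : k ≠ 0) :
    rootAverage (p ^ k) ≤ 0 := by
  unfold rootAverage
  rw [ArithmeticFunction.moebius_apply_prime_pow hp hk]
  split_ifs
  · refine div_nonpos_of_nonpos_of_nonneg ?_ (Nat.cast_nonneg _)
    norm_num
  · simp

/-! ### The averaged alternating sum and its sign -/

/-- The average of the alternating sum `∑ (-1)^|ρ| ζ^(n(ρ))` over the conjugates of a root of
unity `ζ` of order `o`. -/
noncomputable def alternatingAverage (n o : ℕ) : ℚ :=
  ∏ p ∈ n.primeFactors, (1 - rootAverage (p ^ (o.factorization p - (n.factorization p - 1))))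

/-- If v_p(o) < v_p(n), the truncated exponent is 0 and the factor is 1 − 1 = 0. Otherwise the
exponent is positive, the average is at most 0, and the factor is at least 1. -/
theorem one_sub_rootAverage_pos_iff {n o p : ℕ} (hp : p ∈ n.primeFactors) :
    (0 < 1 - rootAverage (p ^ (o.factorization p - (n.factorization p - 1))) ↔
      ¬ o.factorization p < n.factorization p) ∧
    0 ≤ 1 - rootAverage (p ^ (o.factorization p - (n.factorization p - 1))) := by
  by_cases h : o.factorization p < n.factorization p
  · have : o.factorization p - (n.factorization p - 1) = 0 := by omega
    simp [this, rootAverage_one, h]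
  · have hpos : 0 < n.factorization p := by
      rwa [Nat.pos_iff_ne_zero, ← Finsupp.mem_support_iff, Nat.support_factorization]
    have := rootAverage_prime_pow_nonpos (k := o.factorization p - (n.factorization p - 1))
      (Nat.prime_of_mem_primeFactors hp) (by omega)
    simp only [h, not_false_eq_true, iff_true]
    constructor <;> linarith

theorem alternatingAverage_nonneg (n o : ℕ) : 0 ≤ alternatingAverage n o :=
  Finset.prod_nonneg fun _ hp => (one_sub_rootAverage_pos_iff hp).2

theorem alternatingAverage_pos_iff {n o : ℕ} (hn : n ≠ 0) (ho : o ≠ 0) :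
    0 < alternatingAverage n o ↔ n ∣ o := by
  rw [dvd_iff_forall_primeFactors hn ho]
  constructor
  · intro h p hp
    rw [← (one_sub_rootAverage_pos_iff hp).1]
    exact lt_of_le_of_ne (one_sub_rootAverage_pos_iff hp).2
      fun h0 => h.ne' (Finset.prod_eq_zero hp h0.symm)
  · intro h
    exact Finset.prod_pos fun p hp => (one_sub_rootAverage_pos_iff hp).1.2 (h p hp)

/-- The order of ζ^m is o / gcd(o, m). At a prime of ρ the gcd has exponent min(v_p(o), v_p(n) − 1),
which leaves the truncated difference. Elsewhere n(ρ) carries v_p(N) ≥ v_p(o), and nothing is left.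
-/
theorem orderOf_pow_nRho {N n : ℕ} (hN : N ≠ 0) {ζ : ℂ} (hζ : ζ ^ N = 1) {ρ : Finset ℕ}
    (hρ : ρ ⊆ n.primeFactors) :
    orderOf (ζ ^ nRho N n ρ) =
      ∏ p ∈ ρ, p ^ ((orderOf ζ).factorization p - (n.factorization p - 1)) := by
  have ho : orderOf ζ ∣ N := orderOf_dvd_of_pow_eq_one hζ
  have ho0 : orderOf ζ ≠ 0 := ne_zero_of_dvd_ne_zero hN ho
  have hle := (Nat.factorization_le_iff_dvd ho0 hN).2 ho
  have hprime : ∀ p ∈ ρ, p.Prime := fun p hp => Nat.prime_of_mem_primeFactors (hρ hp)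
  rw [orderOf_pow' ζ (nRho_ne_zero N n ρ)]
  refine Nat.eq_of_factorization_eq ?_ ?_ fun q => ?_
  · exact (Nat.div_pos (Nat.le_of_dvd (Nat.pos_of_ne_zero ho0) (Nat.gcd_dvd_left _ _))
      (Nat.gcd_pos_of_pos_left _ (Nat.pos_of_ne_zero ho0))).ne'
  · exact Finset.prod_ne_zero_iff.2 fun p hp => pow_ne_zero _ (hprime p hp).ne_zero
  · rw [Nat.factorization_div (Nat.gcd_dvd_left _ _), Finsupp.tsub_apply,
      Nat.factorization_gcd ho0 (nRho_ne_zero N n ρ), Finsupp.inf_apply, factorization_nRho,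
      Nat.factorization_prod_apply fun p hp => pow_ne_zero _ (hprime p hp).ne_zero]
    have h1 : ∀ p ∈ ρ,
        (p ^ ((orderOf ζ).factorization p - (n.factorization p - 1))).factorization q =
          if p = q then (orderOf ζ).factorization q - (n.factorization q - 1) else 0 := by
      intro p hp
      rw [(hprime p hp).factorization_pow, Finsupp.single_apply]
      split_ifs with h
      · rw [h]
      · rfl
    rw [Finset.sum_congr rfl h1, Finset.sum_ite_eq']
    have := hle q
    split_ifs
    · omega
    · omega

/-- The order of ζ^n(ρ) is a product over ρ of prime powers that do not themselves depend on ρ, and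
the average is multiplicative, so the alternating sum factors over the primes of n. -/
theorem sum_powerset_sum_units {N n : ℕ} [NeZero N] {ζ : ℂ} (hζ : ζ ^ N = 1) :
    ∑ ρ ∈ n.primeFactors.powerset, (-1 : ℂ) ^ ρ.card *
      ∑ k : (ZMod N)ˣ, (ζ ^ nRho N n ρ) ^ (k : ZMod N).val =
        N.totient * (alternatingAverage n (orderOf ζ) : ℂ) := by
  have h1 : ∀ ρ ∈ n.primeFactors.powerset, (-1 : ℂ) ^ ρ.card *
      ∑ k : (ZMod N)ˣ, (ζ ^ nRho N n ρ) ^ (k : ZMod N).val = N.totient * ((-1 : ℂ) ^ ρ.card *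
        ∏ p ∈ ρ, (rootAverage
          (p ^ ((orderOf ζ).factorization p - (n.factorization p - 1))) : ℂ)) := by
    intro ρ hρ
    have hρ' := Finset.mem_powerset.1 hρ
    rw [sum_units_pow (by rw [← pow_mul, mul_comm, pow_mul, hζ, one_pow]),
      orderOf_pow_nRho (NeZero.ne N) hζ hρ', rootAverage_prod_prime_pow _
        fun p hp => Nat.prime_of_mem_primeFactors (hρ' hp)]
    push_cast
    ring
  rw [Finset.sum_congr rfl h1, ← Finset.mul_sum, sum_powerset_neg_one_mul_prod]
  unfold alternatingAverage
  push_cast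
  rfl

end Arithmetic

/-! ### Pairs over cyclic subgroups -/

namespace MonPair

section CyclicPairs

variable {G : Type u} [Group G]

/-- The pair consisting of the trivial subgroup and its trivial character. -/
def trivialPair : MonPair G := ⟨⊥, 1⟩

/-- The characters of ⟨g⟩ are the extensions of the trivial pair by g, so the results on `IsExt`
apply to eigenvalues of a single element. -/
theorem isExt_trivialPair {g : G} {r : MonPair G} :
    IsExt trivialPair g r ↔ r.H = Subgroup.zpowers g := by
  have h : (trivialPair : MonPair G) ≤ r := fun x hx => by
    obtain rfl : x = 1 := Subgroup.mem_bot.1 hx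
    rw [val_one, val_one]
  unfold IsExt
  rw [show (trivialPair : MonPair G).H = ⊥ from rfl, bot_sup_eq]
  exact and_iff_right h

theorem val_pow (p : MonPair G) {x : G} (hx : x ∈ p.H) (m : ℕ) : p.val (x ^ m) = p.val x ^ m := by
  induction m with
  | zero => simp [val_one]
  | succ m ih => rw [pow_succ, val_mul _ (p.H.pow_mem hx m) hx, ih, pow_succ]

theorem val_pow_exponent (p : MonPair G) {x : G} (hx : x ∈ p.H) :
    p.val x ^ Monoid.exponent G = 1 := by
  rw [← val_pow p hx, Monoid.pow_exponent_eq_one, val_one]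

theorem orderOf_dvd_exponent (p : MonPair G) : orderOf p.φ ∣ Monoid.exponent G := by
  refine orderOf_dvd_of_pow_eq_one (MonoidHom.ext fun x => ?_)
  rw [MonoidHom.pow_apply, ← map_pow, MonoidHom.one_apply, ← map_one p.φ]
  congr 1
  ext
  rw [Subgroup.coe_pow, Monoid.pow_exponent_eq_one, Subgroup.coe_one]

theorem mem_of_eq_zpowers {p : MonPair G} {g : G} (h : p.H = Subgroup.zpowers g) : g ∈ p.H := by
  rw [h]
  exact Subgroup.mem_zpowers g

/-- A character of a cyclic group, and each of its powers, is determined by the value at a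
generator. -/
theorem orderOf_eq_of_eq_zpowers {p : MonPair G} {g : G} (h : p.H = Subgroup.zpowers g) :
    orderOf p.φ = orderOf (p.val g) := by
  have hg := mem_of_eq_zpowers h
  rw [orderOf_eq_orderOf_iff]
  intro m
  rw [val_of_mem _ hg]
  constructor
  · intro hm
    have := DFunLike.congr_fun hm ⟨g, hg⟩
    exact congrArg Units.val this
  · intro hm
    have hm' : p.φ ⟨g, hg⟩ ^ m = 1 := Units.ext hm
    refine MonoidHom.ext fun ⟨x, hx⟩ => ?_
    obtain ⟨k, rfl⟩ := Subgroup.mem_zpowers_iff.1 (h ▸ hx)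
    have : (⟨g ^ k, hx⟩ : p.H) = (⟨g, hg⟩ : p.H) ^ k := rfl
    rw [MonoidHom.pow_apply, this, map_zpow, ← zpow_natCast, ← zpow_mul, mul_comm, zpow_mul,
      zpow_natCast, hm', one_zpow, MonoidHom.one_apply]

open Classical in
-- A pair below `r` is determined by its subgroup, so only the restriction of `r` can occur.
theorem filter_zpowers_le [Fintype (MonPair G)] (r : MonPair G) (g : G) :
    (Finset.univ.filter fun p : MonPair G => p.H = Subgroup.zpowers g ∧ p ≤ r) =
      if h : g ∈ r.H then {r.restr (Subgroup.zpowers g) (by simpa using h)} else ∅ := by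
  ext p
  split_ifs with h
  · simp only [Finset.mem_filter, Finset.mem_univ, true_and, Finset.mem_singleton]
    constructor
    · rintro ⟨h1, h2⟩
      exact eq_of_le_le h2 (restr_le _ _ _) h1
    · rintro rfl
      exact ⟨rfl, restr_le _ _ _⟩
  · simp only [Finset.mem_filter, Finset.mem_univ, true_and, Finset.notMem_empty, iff_false]
    rintro ⟨h1, h2⟩
    exact h (H_le h2 (mem_of_eq_zpowers h1))

open Classical in
-- Orthogonality for the character φ^m of H. The explicit condition g ∈ H matters for m = 0, where
-- `val` vanishes off H but 0^0 = 1.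
theorem sum_val_pow [Fintype G] (p : MonPair G) (m : ℕ) :
    ∑ g : G, (if g ∈ p.H then p.val g ^ m else 0) =
      if orderOf p.φ ∣ m then (Nat.card p.H : ℂ) else 0 := by
  rw [← Finset.sum_filter, Finset.sum_subtype (p := fun g => g ∈ p.H) _ (by simp)]
  have h1 : ∀ h : p.H, p.val (h : G) ^ m = ((Units.coeHom ℂ).comp (p.φ ^ m)) h := fun h => by
    rw [val_of_mem _ h.2]
    simp
  have h2 : (Units.coeHom ℂ).comp (p.φ ^ m) = 1 ↔ orderOf p.φ ∣ m := by
    rw [orderOf_dvd_iff_pow_eq_one]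
    constructor
    · intro h
      refine MonoidHom.ext fun x => Units.ext ?_
      exact DFunLike.congr_fun h x
    · intro h
      rw [h]
      rfl
  rw [Finset.sum_congr rfl fun h _ => h1 h, sum_hom_units]
  simp only [h2, Nat.card_eq_fintype_card]
  push_cast
  rfl

open Classical in
/-- The divisibility `o(φ) ∣ m`, expressed through the marks of the cyclic pairs. -/
theorem sum_val_pow_mul_weight [Fintype G] [Fintype (MonPair G)] (q : MonPair G) (m : ℕ) :
    ∑ g : G, ∑ p : MonPair G with p.H = Subgroup.zpowers g, p.val g ^ m * (weight p q : ℂ) =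
      if orderOf q.φ ∣ m then (Nat.card G : ℂ) else 0 := by
  have h0 : (Nat.card q.H : ℂ) ≠ 0 := by
    have := card_H_pos q
    exact_mod_cast this.ne'
  have hw : ∀ p : MonPair G, (weight p q : ℂ) =
      (∑ x : G, if p ≤ x • q then (1 : ℂ) else 0) / Nat.card q.H := by
    intro p
    unfold weight
    rw [Nat.card_eq_fintype_card (α := {g : G // p ≤ g • q}), Fintype.card_subtype,
      Finset.sum_boole]
    push_cast
    rfl
  -- After the sums over p and x are exchanged, at most one p on ⟨g⟩ lies below x • q; it exists
  -- exactly when g lies in the conjugate subgroup, and it takes there the value of x • q at g.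
  have hg : ∀ g : G, ∑ p : MonPair G with p.H = Subgroup.zpowers g,
      p.val g ^ m * (weight p q : ℂ) =
        (∑ x : G, if g ∈ (x • q).H then (x • q).val g ^ m else 0) / Nat.card q.H := by
    intro g
    simp only [hw, ← mul_div_assoc]
    rw [← Finset.sum_div]
    congr 1
    simp only [Finset.mul_sum]
    rw [Finset.sum_comm]
    refine Finset.sum_congr rfl fun x _ => ?_
    simp only [mul_ite, mul_one, mul_zero]
    rw [← Finset.sum_filter, Finset.filter_filter, filter_zpowers_le]
    split_ifs with h
    · rw [Finset.sum_singleton, ← restr_le (x • q) (Subgroup.zpowers g) (by simpa using h) g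
        (Subgroup.mem_zpowers g)]
    · rw [Finset.sum_empty]
  -- For each x, the sum over g is orthogonality on the conjugate of H by x, where the order of the
  -- character and the size of the subgroup are those of q. So all |G| values of x contribute
  -- equally.
  rw [Finset.sum_congr rfl fun g _ => hg g, ← Finset.sum_div, Finset.sum_comm]
  simp only [sum_val_pow, orderOf_smul, card_smul]
  rw [Finset.sum_const, Finset.card_univ, nsmul_eq_mul, ← Nat.card_eq_fintype_card]
  split_ifs
  · rw [mul_div_assoc, div_self h0, mul_one]
  · simp

variable {V : Type} [AddCommGroup V] [Module ℂ V]

open Classical in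
-- The operator ρ(g) is diagonalizable, its eigenspaces are the spaces on which ⟨g⟩ acts through a
-- character, and ρ(g^m) is a scalar on each of them.
theorem trace_pow_eq_sum [Fintype G] [Fintype (MonPair G)] [FiniteDimensional ℂ V]
    (ρ : G →* Module.End ℂ V) (g : G) (m : ℕ) :
    LinearMap.trace ℂ V (ρ (g ^ m)) =
      ∑ p : MonPair G with p.H = Subgroup.zpowers g,
        (Module.finrank ℂ (eigen ρ p) : ℂ) * p.val g ^ m := by
  let N : {r : MonPair G // r.H = Subgroup.zpowers g} → Submodule ℂ V := fun r => eigen ρ r.1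
  have heigen : ∀ r, N r = Module.End.eigenspace (ρ g) (r.1.val g) := fun r => by
    rw [show N r = _ from eigen_of_isExt (isExt_trivialPair.2 r.2), inf_eq_right]
    intro v _ x hx
    obtain rfl : x = 1 := Subgroup.mem_bot.1 hx
    rw [map_one, val_one, one_smul, Module.End.one_apply]
  have hind : iSupIndep N := by
    rw [show N = fun r => _ from funext heigen]
    exact (Module.End.eigenspaces_iSupIndep (ρ g)).comp fun r s h =>
      Subtype.ext (isExt_ext (isExt_trivialPair.2 r.2) (isExt_trivialPair.2 s.2) h)
  -- Every eigenvector of ρ(g) lies in one of these spaces, because its eigenvalue is the value at g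
  -- of a character of ⟨g⟩.
  have hsup : ⨆ r, N r = ⊤ := by
    rw [eq_top_iff, ← iSup_eigenspace_top ρ g]
    refine iSup_le fun μ v hv => ?_
    by_cases hv0 : v = 0
    · rw [hv0]
      exact Submodule.zero_mem _
    · obtain ⟨r, hr, hrg⟩ := exists_isExt (p := trivialPair) (ρ := ρ) hv0 (fun x hx => by
        obtain rfl : x = 1 := Subgroup.mem_bot.1 hx
        rw [map_one, val_one, one_smul, Module.End.one_apply]) (Module.End.mem_eigenspace_iff.1 hv)
      refine Submodule.mem_iSup_of_mem ⟨r, isExt_trivialPair.1 hr⟩ ?_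
      rw [heigen, hrg]
      exact hv
  have hint : DirectSum.IsInternal N :=
    (DirectSum.isInternal_submodule_iff_iSupIndep_and_iSup_eq_top N).2 ⟨hind, hsup⟩
  have hact : ∀ r : {r : MonPair G // r.H = Subgroup.zpowers g}, ∀ v ∈ N r,
      ρ (g ^ m) v = r.1.val g ^ m • v := by
    intro r v hv
    have hg := mem_of_eq_zpowers r.2
    rw [hv _ (r.1.H.pow_mem hg m), val_pow _ hg]
  have hmaps : ∀ r, Set.MapsTo (ρ (g ^ m)) (N r) (N r) := fun r v hv => by
    rw [SetLike.mem_coe, hact r v hv]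
    exact (N r).smul_mem _ hv
  rw [LinearMap.trace_eq_sum_trace_restrict hint hmaps,
    Finset.sum_subtype (p := fun p : MonPair G => p.H = Subgroup.zpowers g) _ (by simp)]
  refine Finset.sum_congr rfl fun r _ => ?_
  have : (ρ (g ^ m)).restrict (hmaps r) = (r.1.val g ^ m) • (1 : Module.End ℂ (N r)) := by
    ext v
    exact hact r v v.2
  rw [this, map_smul, LinearMap.trace_one, smul_eq_mul, mul_comm]

end CyclicPairs

end MonPair

/-! ### The invariant S(G, χ, n) and the Adams operations -/

section Invariant

open MonPair

variable {G : Type u} [Group G] {d : ℕ}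

/-- The action on `ℂ^d` given by a matrix representation. -/
noncomputable def toEnd (X : G →* Matrix.GeneralLinearGroup (Fin d) ℂ) :
    G →* Module.End ℂ (Fin d → ℂ) :=
  ((Matrix.toLinAlgEquiv' : Matrix (Fin d) (Fin d) ℂ ≃ₐ[ℂ] _) :
    Matrix (Fin d) (Fin d) ℂ →* Module.End ℂ (Fin d → ℂ)).comp ((Units.coeHom _).comp X)

theorem charOf_eq_trace (X : G →* Matrix.GeneralLinearGroup (Fin d) ℂ) :
    charOf X = fun g => LinearMap.trace ℂ _ (toEnd X g) :=
  funext fun _ => (Matrix.trace_toLin'_eq _).symm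

theorem schurInner_linChar_one [Fintype G] (f : G → ℂ) :
    schurInner f (linChar (1 : G →* ℂˣ)) = (Nat.card G : ℂ)⁻¹ * ∑ g : G, f g := by
  unfold schurInner linChar
  rw [finsum_eq_sum_of_fintype]
  simp

/-- The line spanned by an eigenvector of 𝒳(x) is stable under ⟨x⟩, which acts on it through a
character. -/
theorem exists_eigen_ne_bot {X : G →* Matrix.GeneralLinearGroup (Fin d) ℂ} {x : G} {ζ : ℂ}
    (h : Module.End.HasEigenvalue (toEnd X x) ζ) :
    ∃ p : MonPair G, p.H = Subgroup.zpowers x ∧ p.val x = ζ ∧ eigen (toEnd X) p ≠ ⊥ := by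
  obtain ⟨v, hv⟩ := h.exists_hasEigenvector
  have h1 : v ∈ eigen (toEnd X) trivialPair := fun y hy => by
    obtain rfl : y = 1 := Subgroup.mem_bot.1 hy
    rw [map_one, val_one, one_smul, Module.End.one_apply]
  obtain ⟨r, hr, hrx⟩ := exists_isExt hv.2 h1 hv.apply_eq_smul
  refine ⟨r, isExt_trivialPair.1 hr, hrx, (Submodule.ne_bot_iff _).2 ⟨v, ?_, hv.2⟩⟩
  rw [eigen_of_isExt hr, hrx]
  exact ⟨h1, hv.1⟩

theorem hasEigenvalue_of_eigen_ne_bot {X : G →* Matrix.GeneralLinearGroup (Fin d) ℂ}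
    {p : MonPair G} (hp : eigen (toEnd X) p ≠ ⊥) {x : G} (hx : x ∈ p.H) :
    Module.End.HasEigenvalue (toEnd X x) (p.val x) := by
  obtain ⟨v, hv, hv0⟩ := (Submodule.ne_bot_iff _).1 hp
  exact Module.End.hasEigenvalue_of_hasEigenvector (x := v)
    ⟨Module.End.mem_eigenspace_iff.2 (hv x hx), hv0⟩

variable [Finite G]

theorem mult_charOf (X : G →* Matrix.GeneralLinearGroup (Fin d) ℂ) (p : MonPair G) :
    mult (charOf X) p = Module.finrank ℂ (eigen (toEnd X) p) := by
  rw [charOf_eq_trace, mult_trace]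

open Classical in
/-- `(Ψ^m χ, 1)` is the sum of the coefficients of the classes `[H, φ]` with `φ ^ m = 1`. -/
theorem sum_coeff_eq_schurInner [Fintype (Cls G)]
    (X : G →* Matrix.GeneralLinearGroup (Fin d) ℂ) (m : ℕ) :
    ∑ c : Cls G, (coeff (charOfMem X) c : ℂ) * (if clsOrder c ∣ m then 1 else 0) =
      schurInner (adams m (charOf X)) (linChar (1 : G →* ℂˣ)) := by
  have := Fintype.ofFinite G
  have := Fintype.ofFinite (MonPair G)
  have hG : (Nat.card G : ℂ) ≠ 0 := by exact_mod_cast (Nat.card_pos (α := G)).ne'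
  -- Canonicity enters only here: the marks of a_G(χ) are the multiplicities, that is, dimensions of
  -- eigenspaces.
  have hmark : ∀ p : MonPair G, ∑ c : Cls G, (coeff (charOfMem X) c : ℂ) * (weight p c.out : ℂ) =
      Module.finrank ℂ (eigen (toEnd X) p) := by
    intro p
    rw [← mult_charOf]
    refine Eq.trans ?_ (isCanonical_canonicalInduction.mark_eq G (charOfMem X) p)
    rw [mark_eq_sum]
    push_cast
    symm
    refine Finset.sum_subset (Finset.subset_univ _) fun c _ hc => ?_
    rw [Finsupp.notMem_support_iff] at hc
    rw [hc, Int.cast_zero, zero_mul]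
  have horder : ∀ c : Cls G, (if clsOrder c ∣ m then (Nat.card G : ℂ) else 0) =
      ∑ g : G, ∑ p : MonPair G with p.H = Subgroup.zpowers g,
        p.val g ^ m * (weight p c.out : ℂ) := by
    intro c
    rw [sum_val_pow_mul_weight]
    -- `clsOrder` reduces only on the class of an explicit pair.
    conv_lhs => rw [← cls_out c]
    rfl
  rw [schurInner_linChar_one, eq_inv_mul_iff_mul_eq₀ hG, Finset.mul_sum]
  -- The indicator of o(φ) ∣ m is expanded in cyclic marks. Summing over the classes first turns
  -- coefficients into multiplicities, and what is left is the eigenvalue expansion of χ(g^m).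
  calc ∑ c : Cls G, (Nat.card G : ℂ) * ((coeff (charOfMem X) c : ℂ) *
          (if clsOrder c ∣ m then 1 else 0))
      = ∑ c : Cls G, ∑ g : G, ∑ p : MonPair G with p.H = Subgroup.zpowers g,
          p.val g ^ m * ((coeff (charOfMem X) c : ℂ) * (weight p c.out : ℂ)) := by
        refine Finset.sum_congr rfl fun c _ => ?_
        have h1 : (Nat.card G : ℂ) * ((coeff (charOfMem X) c : ℂ) *
            (if clsOrder c ∣ m then 1 else 0)) = (coeff (charOfMem X) c : ℂ) *
              (if clsOrder c ∣ m then (Nat.card G : ℂ) else 0) := by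
          split_ifs <;> ring
        rw [h1, horder]
        simp only [Finset.mul_sum]
        refine Finset.sum_congr rfl fun g _ => Finset.sum_congr rfl fun p _ => ?_
        ring
    _ = ∑ g : G, ∑ p : MonPair G with p.H = Subgroup.zpowers g,
          p.val g ^ m * Module.finrank ℂ (eigen (toEnd X) p) := by
        rw [Finset.sum_comm]
        refine Finset.sum_congr rfl fun g _ => ?_
        rw [Finset.sum_comm]
        refine Finset.sum_congr rfl fun p _ => ?_
        rw [← Finset.mul_sum, hmark]
    _ = ∑ g : G, adams m (charOf X) g := by
        refine Finset.sum_congr rfl fun g _ => ?_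
        simp only [adams, charOf_eq_trace, trace_pow_eq_sum]
        exact Finset.sum_congr rfl fun p _ => mul_comm _ _

/-- After the sums are exchanged, the alternating sum over ρ at a fixed class is the indicator of n
∣ o(φ), since o(φ) divides the exponent. -/
theorem invS_eq_sum (X : G →* Matrix.GeneralLinearGroup (Fin d) ℂ) {n : ℕ}
    (hn : n ∣ Monoid.exponent G) :
    (invS (charOfMem X) n : ℂ) = ∑ ρ ∈ n.primeFactors.powerset, (-1 : ℂ) ^ ρ.card *
      schurInner (adams (nRho (Monoid.exponent G) n ρ) (charOf X)) (linChar (1 : G →* ℂˣ)) := by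
  classical
  have := Fintype.ofFinite (Cls G)
  have hc : ∀ c : Cls G, clsOrder c ∣ Monoid.exponent G := fun c => by
    rw [← cls_out c]
    exact orderOf_dvd_exponent _
  simp only [← sum_coeff_eq_schurInner, Finset.mul_sum]
  rw [Finset.sum_comm, invS, finsum_eq_sum_of_fintype]
  push_cast
  refine Finset.sum_congr rfl fun c _ => ?_
  have h1 := sum_powerset_dvd_nRho Monoid.exponent_ne_zero_of_finite hn (hc c)
  rw [Finset.sum_congr rfl fun ρ _ => mul_left_comm _ _ _, ← Finset.mul_sum, h1]
  simp

/-! ### Nonnegativity and positivity -/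

open Classical in
/-- `|G| S(G, χ, n)` as a sum of nonnegative terms. -/
theorem card_mul_invS [Fintype G] [Fintype (MonPair G)]
    (X : G →* Matrix.GeneralLinearGroup (Fin d) ℂ) {n : ℕ} (hn : n ∣ Monoid.exponent G) :
    (Nat.card G : ℚ) * invS (charOfMem X) n =
      ∑ g : G, ∑ p : MonPair G with p.H = Subgroup.zpowers g,
        (Module.finrank ℂ (eigen (toEnd X) p) : ℚ) * alternatingAverage n (orderOf (p.val g)) := by
  have hG : (Nat.card G : ℂ) ≠ 0 := by exact_mod_cast (Nat.card_pos (α := G)).ne'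
  have hN : NeZero (Monoid.exponent G) := ⟨Monoid.exponent_ne_zero_of_finite⟩
  have hT : ((Monoid.exponent G).totient : ℂ) ≠ 0 := by
    exact_mod_cast (Nat.totient_pos.2 (NeZero.pos (Monoid.exponent G))).ne'
  -- For k prime to the exponent, g ↦ g^k is a permutation of G, inverted by the power k⁻¹.
  have hshift : ∀ (m : ℕ) (k : (ZMod (Monoid.exponent G))ˣ),
      ∑ g : G, charOf X (g ^ m) =
        ∑ g : G, charOf X (g ^ (m * (k : ZMod (Monoid.exponent G)).val)) := by
    intro m k
    have hinv : ∀ (l : (ZMod (Monoid.exponent G))ˣ) (g : G),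
        (g ^ (l : ZMod (Monoid.exponent G)).val) ^
          ((l⁻¹ : (ZMod (Monoid.exponent G))ˣ) : ZMod (Monoid.exponent G)).val = g := by
      intro l g
      rw [← pow_mul]
      nth_rewrite 2 [← pow_one g]
      rw [pow_eq_pow_iff_modEq]
      refine Nat.ModEq.of_dvd (Monoid.order_dvd_exponent g) ?_
      rw [← ZMod.natCast_eq_natCast_iff]
      simp
    refine (Fintype.sum_equiv
      { toFun := fun g => g ^ (k : ZMod (Monoid.exponent G)).val
        invFun := fun g => g ^ ((k⁻¹ : (ZMod (Monoid.exponent G))ˣ) : ZMod (Monoid.exponent G)).val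
        left_inv := hinv k
        right_inv := fun g => by simpa using hinv k⁻¹ g } _ _ fun g => ?_).symm
    change _ = charOf X ((g ^ (k : ZMod (Monoid.exponent G)).val) ^ m)
    rw [← pow_mul, mul_comm]
  -- Summing over all such k replaces each eigenvalue power by the sum of its conjugates, counted
  -- over the units modulo N.
  have havg : ∀ m : ℕ, ((Monoid.exponent G).totient : ℂ) * ∑ g : G, charOf X (g ^ m) =
      ∑ g : G, ∑ p : MonPair G with p.H = Subgroup.zpowers g,
        (Module.finrank ℂ (eigen (toEnd X) p) : ℂ) *
          ∑ k : (ZMod (Monoid.exponent G))ˣ,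
            (p.val g ^ m) ^ (k : ZMod (Monoid.exponent G)).val := by
    intro m
    rw [← ZMod.card_units_eq_totient, ← nsmul_eq_mul, ← Finset.card_univ, ← Finset.sum_const,
      Finset.sum_congr rfl fun k _ => hshift m k, Finset.sum_comm]
    refine Finset.sum_congr rfl fun g _ => ?_
    simp only [charOf_eq_trace, trace_pow_eq_sum, Finset.mul_sum]
    rw [Finset.sum_comm]
    simp only [pow_mul]
  have key : ((Monoid.exponent G).totient : ℂ) * (Nat.card G * invS (charOfMem X) n) =
      (Monoid.exponent G).totient * ∑ g : G, ∑ p : MonPair G with p.H = Subgroup.zpowers g,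
        (Module.finrank ℂ (eigen (toEnd X) p) : ℂ) * alternatingAverage n (orderOf (p.val g)) := by
    calc ((Monoid.exponent G).totient : ℂ) * (Nat.card G * invS (charOfMem X) n)
        = ∑ ρ ∈ n.primeFactors.powerset, (-1 : ℂ) ^ ρ.card * ((Monoid.exponent G).totient *
            ∑ g : G, charOf X (g ^ nRho (Monoid.exponent G) n ρ)) := by
          rw [invS_eq_sum X hn]
          simp only [schurInner_linChar_one, adams, Finset.mul_sum (s := n.primeFactors.powerset)]
          refine Finset.sum_congr rfl fun ρ _ => ?_
          field_simp
      _ = ∑ g : G, ∑ p : MonPair G with p.H = Subgroup.zpowers g,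
            (Module.finrank ℂ (eigen (toEnd X) p) : ℂ) *
              ∑ ρ ∈ n.primeFactors.powerset, (-1 : ℂ) ^ ρ.card *
                ∑ k : (ZMod (Monoid.exponent G))ˣ, (p.val g ^ nRho (Monoid.exponent G) n ρ) ^
                  (k : ZMod (Monoid.exponent G)).val := by
          simp only [havg]
          rw [Finset.sum_congr rfl fun ρ _ => Finset.mul_sum _ _ _, Finset.sum_comm]
          refine Finset.sum_congr rfl fun g _ => ?_
          rw [Finset.sum_congr rfl fun ρ _ => Finset.mul_sum _ _ _, Finset.sum_comm]
          refine Finset.sum_congr rfl fun p _ => ?_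
          rw [Finset.mul_sum]
          exact Finset.sum_congr rfl fun ρ _ => mul_left_comm _ _ _
      _ = _ := by
          rw [Finset.mul_sum]
          refine Finset.sum_congr rfl fun g _ => ?_
          rw [Finset.mul_sum]
          refine Finset.sum_congr rfl fun p hp => ?_
          rw [sum_powerset_sum_units
            (val_pow_exponent p (mem_of_eq_zpowers (Finset.mem_filter.1 hp).2)), mul_left_comm]
  have := mul_left_cancel₀ hT key
  -- Both sides are rational, so the identity in ℂ descends to ℚ, where signs can be compared.
  exact_mod_cast this

theorem invS_nonneg (X : G →* Matrix.GeneralLinearGroup (Fin d) ℂ) {n : ℕ}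
    (hn : n ∣ Monoid.exponent G) : 0 ≤ invS (charOfMem X) n := by
  classical
  have := Fintype.ofFinite G
  have := Fintype.ofFinite (MonPair G)
  have hG : (0 : ℚ) < Nat.card G := by exact_mod_cast Nat.card_pos (α := G)
  have h : (0 : ℚ) ≤ Nat.card G * invS (charOfMem X) n := by
    rw [card_mul_invS X hn]
    exact Finset.sum_nonneg fun g _ => Finset.sum_nonneg fun p _ =>
      mul_nonneg (Nat.cast_nonneg _) (alternatingAverage_nonneg _ _)
  exact_mod_cast nonneg_of_mul_nonneg_right h hG

/-- A sum of nonnegative terms is positive exactly when one term is, which means a nonzero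
eigenspace together with a positive alternating average. -/
theorem invS_pos_iff (X : G →* Matrix.GeneralLinearGroup (Fin d) ℂ) {n : ℕ}
    (hn : n ∣ Monoid.exponent G) : 0 < invS (charOfMem X) n ↔
      ∃ (g : G) (p : MonPair G), p.H = Subgroup.zpowers g ∧ eigen (toEnd X) p ≠ ⊥ ∧
        n ∣ orderOf (p.val g) := by
  classical
  have := Fintype.ofFinite G
  have := Fintype.ofFinite (MonPair G)
  have hN : Monoid.exponent G ≠ 0 := Monoid.exponent_ne_zero_of_finite
  have hG : (0 : ℚ) < Nat.card G := by exact_mod_cast Nat.card_pos (α := G)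
  have h0 : ∀ (g : G) (p : MonPair G), 0 ≤ (Module.finrank ℂ (eigen (toEnd X) p) : ℚ) *
      alternatingAverage n (orderOf (p.val g)) := fun g p =>
    mul_nonneg (Nat.cast_nonneg _) (alternatingAverage_nonneg _ _)
  have h1 : 0 < invS (charOfMem X) n ↔ (0 : ℚ) < Nat.card G * invS (charOfMem X) n := by
    rw [mul_pos_iff_of_pos_left hG]
    exact_mod_cast Iff.rfl
  rw [h1, card_mul_invS X hn,
    Finset.sum_pos_iff_of_nonneg fun g _ => Finset.sum_nonneg fun p _ => h0 g p]
  simp only [Finset.mem_univ, true_and]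
  refine exists_congr fun g => ?_
  rw [Finset.sum_pos_iff_of_nonneg fun p _ => h0 g p]
  refine exists_congr fun p => ?_
  simp only [Finset.mem_filter, Finset.mem_univ, true_and]
  refine and_congr_right fun hp => ?_
  have ho : orderOf (p.val g) ≠ 0 := ne_zero_of_dvd_ne_zero hN
    (orderOf_dvd_of_pow_eq_one (val_pow_exponent p (mem_of_eq_zpowers hp)))
  rw [← alternatingAverage_pos_iff (ne_zero_of_dvd_ne_zero hN hn) ho, ← Submodule.one_le_finrank_iff]
  constructor
  · intro h
    have hf := pos_of_mul_pos_left h (alternatingAverage_nonneg _ _)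
    have ha := pos_of_mul_pos_right h (Nat.cast_nonneg _)
    exact ⟨by exact_mod_cast hf, ha⟩
  · rintro ⟨hf, ha⟩
    exact mul_pos (by exact_mod_cast hf) ha

/-- Positivity is in the partial order of ℂ; the multiplicity is the dimension of the eigenspace. -/
theorem mult_charOf_pos_iff (X : G →* Matrix.GeneralLinearGroup (Fin d) ℂ) (p : MonPair G) :
    0 < mult (charOf X) p ↔ eigen (toEnd X) p ≠ ⊥ := by
  rw [mult_charOf, Nat.cast_pos, ← Submodule.one_le_finrank_iff]
  rfl

/-- The image of φ is a finite subgroup of ℂˣ, hence cyclic; any h mapping to a generator will do.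
-/
theorem exists_orderOf_apply_eq {H : Type*} [Group H] [Finite H] (φ : H →* ℂˣ) :
    ∃ h : H, orderOf (φ h) = orderOf φ := by
  have : Finite φ.range := Finite.of_surjective φ.rangeRestrict φ.rangeRestrict_surjective
  obtain ⟨⟨_, h, rfl⟩, hz⟩ := IsCyclic.exists_generator (α := φ.range)
  refine ⟨h, Nat.dvd_antisymm ?_ ?_⟩
  · refine orderOf_dvd_of_pow_eq_one ?_
    rw [← MonoidHom.pow_apply, pow_orderOf_eq_one, MonoidHom.one_apply]
  · refine orderOf_dvd_of_pow_eq_one (MonoidHom.ext fun y => ?_)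
    obtain ⟨k, hk⟩ := Subgroup.mem_zpowers_iff.1 (hz ⟨φ y, y, rfl⟩)
    have hk' : φ h ^ k = φ y := congrArg Subtype.val hk
    rw [MonoidHom.pow_apply, ← hk', ← zpow_natCast, ← zpow_mul, mul_comm, zpow_mul, zpow_natCast,
      pow_orderOf_eq_one, one_zpow, MonoidHom.one_apply]

end Invariant

end BrauerInduction

/-! ### The theorem, with the equivalences of (c) -/

theorem theoremB {G : Type u} [Group G] [Finite G] {d : ℕ}
    (X : G →* Matrix.GeneralLinearGroup (Fin d) ℂ) (n : ℕ) (hn : n ∣ Monoid.exponent G) :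
    ((BrauerInduction.invS (BrauerInduction.charOfMem X) n : ℤ) : ℂ) =
        ∑ ρ ∈ n.primeFactors.powerset, (-1 : ℂ) ^ ρ.card *
          BrauerInduction.schurInner
            (BrauerInduction.adams (BrauerInduction.nRho (Monoid.exponent G) n ρ)
              (BrauerInduction.charOf X))
            (BrauerInduction.linChar (1 : G →* ℂˣ)) ∧
      0 ≤ BrauerInduction.invS (BrauerInduction.charOfMem X) n ∧
      List.TFAE [
        ∃ (H : Subgroup G) (φ : H →* ℂˣ),
          0 < BrauerInduction.schurInner (fun h : H => BrauerInduction.charOf X (h : G))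
            (BrauerInduction.linChar φ) ∧ n = orderOf φ,
        0 < BrauerInduction.invS (BrauerInduction.charOfMem X) n,
        ∃ (x : G) (ζ : ℂ),
          Module.End.HasEigenvalue (Matrix.toLin' (X x : Matrix (Fin d) (Fin d) ℂ)) ζ ∧
            n = orderOf ζ] := by
  open BrauerInduction BrauerInduction.MonPair in
  have hN : Monoid.exponent G ≠ 0 := Monoid.exponent_ne_zero_of_finite
  refine ⟨invS_eq_sum X hn, invS_nonneg X hn, ?_⟩
  tfae_have 1 → 3 := by
    rintro ⟨H, φ, hφ, rfl⟩
    obtain ⟨h, hh⟩ := exists_orderOf_apply_eq φ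
    have hp := (mult_charOf_pos_iff X ⟨H, φ⟩).1 hφ
    refine ⟨h, _, hasEigenvalue_of_eigen_ne_bot hp h.2, ?_⟩
    rw [val_of_mem _ h.2, ← hh]
    exact orderOf_units.symm
  tfae_have 3 → 1 := by
    rintro ⟨x, ζ, hζ, rfl⟩
    obtain ⟨p, hpx, rfl, hp⟩ := exists_eigen_ne_bot (X := X) hζ
    -- Here H = ⟨x⟩, and the order of its character is that of the value ζ at the generator x.
    exact ⟨p.H, p.φ, (mult_charOf_pos_iff X p).2 hp, (orderOf_eq_of_eq_zpowers hpx).symm⟩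
  tfae_have 3 → 2 := by
    rintro ⟨x, ζ, hζ, rfl⟩
    obtain ⟨p, hpx, rfl, hp⟩ := exists_eigen_ne_bot (X := X) hζ
    exact (invS_pos_iff X hn).2 ⟨x, p, hpx, hp, dvd_rfl⟩
  tfae_have 2 → 3 := by
    intro h
    obtain ⟨g, p, hpg, hp, k, hk⟩ := (invS_pos_iff X hn).1 h
    have hg := mem_of_eq_zpowers hpg
    have ho : orderOf (p.val g) ≠ 0 := ne_zero_of_dvd_ne_zero hN
      (orderOf_dvd_of_pow_eq_one (val_pow_exponent p hg))
    have hk0 : k ≠ 0 := by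
      rintro rfl
      exact ho hk
    -- The eigenvalue of 𝒳(g) has order nk, so its k-th power, an eigenvalue of 𝒳(g^k), has order n.
    refine ⟨g ^ k, _, hasEigenvalue_of_eigen_ne_bot hp (p.H.pow_mem hg k), ?_⟩
    rw [val_pow _ hg, orderOf_pow_of_dvd hk0 (Dvd.intro_left n hk.symm), hk,
      Nat.mul_div_cancel _ (Nat.pos_of_ne_zero hk0)]
  tfae_finish
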